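/- For $S\subseteq\mathbb{R}^2$, let the Helly number $\mathrm{He}(S)$ be the smallest positive integer $k$ with the following property: whenever $\mathcal F$ is a finite family of convex sets in $\mathbb{R}^2$ such that $\bigcap\mathcal G$ meets $S$ for every subfamily $\mathcal G\subseteq\mathcal F$ with at most $k$ members, then $\bigcap\mathcal F$ meets $S$ ($\mathrm{He}(S)=\infty$ if there is no such $k$). For an integer $m\ge 2$, let the Tverberg number $\mathrm{Tv}(S,m)$ be the smallest positive integer $n$ such that every multiset of $n$ points of $S$ can be partitioned (respecting multiplicities) into $m$ submultisets $A_1,\dots,A_m$ with $\bigl(\bigcap_{i=1}^m\mathrm{conv}(A_i)\bigr)\cap S\neq\varnothing$ ($\mathrm{Tv}(S,m)=\infty$ if there is no such $n$). Let $S$ be a nonempty discrete subset of $\mathbb{R}^2$ with $\mathrm{He}(S)<\infty$. Then (1) $\mathrm{Tv}(S,m)=\mathrm{He}(S)(m-1)+1$ for every $m\ge 3$; (2) if $\mathrm{He}(S)\le 3$, then $\mathrm{Tv}(S,2)=\mathrm{He}(S)+1$; (3) if $\mathrm{He}(S)\ge 4$, then $\mathrm{He}(S)+1\le\mathrm{Tv}(S,2)\le\mathrm{He}(S)+2$.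 Both values in (3) are possible: there are nonempty discrete sets $S\subset\mathbb{R}^2$ with $\mathrm{He}(S)=4$ and $\mathrm{Tv}(S,2)=\mathrm{He}(S)+1$, and nonempty discrete sets $S\subset\mathbb{R}^2$ with $\mathrm{He}(S)=4$ and $\mathrm{Tv}(S,2)=\mathrm{He}(S)+2$. Moreover (Doignon's theorem), $\mathrm{Tv}(\mathbb{Z}^2,m)=4m-3$ for every $m\ge 3$. -/

import Mathlib

/-- The Helly property of `S` at level `k`: a finite family `F` of convex sets has a common point
in `S` as soon as every subfamily with at most `k` members has a common point in `S`. -/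
def HellyProperty {E : Type*} [AddCommGroup E] [Module ℝ E] (S : Set E) (k : ℕ) : Prop :=
  ∀ F : Finset (Set E), (∀ C ∈ F, Convex ℝ C) →
    (∀ G : Finset (Set E), G ⊆ F → G.card ≤ k → (⋂₀ (G : Set (Set E)) ∩ S).Nonempty) →
    (⋂₀ (F : Set (Set E)) ∩ S).Nonempty

/-- The Helly number `He(S)`: the smallest positive integer `k` for which the Helly property
holds, and `⊤` if there is none. -/
noncomputable def hellyNumber {E : Type*} [AddCommGroup E] [Module ℝ E] (S : Set E) : ℕ∞ :=
  sInf {N : ℕ∞ | ∃ k : ℕ, 0 < k ∧ HellyProperty S k ∧ N = k}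

/-- The multiset `A` can be partitioned into `m` submultisets whose convex hulls have a common
point in `S`. The parts are automatically nonempty, since the convex hull of the empty set
is empty. -/
def HasTverbergPartition {E : Type*} [AddCommGroup E] [Module ℝ E] (S : Set E) (m : ℕ)
    (A : Multiset E) : Prop :=
  ∃ B : Fin m → Multiset E, ∑ i, B i = A ∧ ∃ p ∈ S, ∀ i, p ∈ convexHull ℝ {x | x ∈ B i}

/-- The Tverberg number `Tv(S, m)`: the smallest positive integer `n` such that every multiset of
`n` points of `S` has a partition into `m` parts whose convex hulls have a common point in `S`,
and `⊤` if there is none. -/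
noncomputable def tverbergNumber {E : Type*} [AddCommGroup E] [Module ℝ E] (S : Set E) (m : ℕ) :
    ℕ∞ :=
  sInf {N : ℕ∞ | ∃ n : ℕ, 0 < n ∧
    (∀ A : Multiset E, A.card = n → (∀ x ∈ A, x ∈ S) → HasTverbergPartition S m A) ∧ N = n}

/-- The integer lattice `ℤ²` in the plane. -/
def integerLattice : Set (EuclideanSpace ℝ (Fin 2)) :=
  {x | ∀ i, ∃ a : ℤ, x i = a}

/-!
Write `h = He(S)`. By Hoffman's criterion there are `h` points `T ⊆ S` whose hulls `conv (T \ {t})`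
have no common point in `S`. Taking each of them `m - 1` times gives `h (m - 1)` points without a
Tverberg partition, because every `t ∈ T` is missing from some part (`le_tverbergNumber`).

For the upper bounds, `h (m - 1) + 1` points of `S` have a centerpoint in `S`: the hulls of the
subfamilies missing at most `m - 1` points have a common point `p ∈ S`
(`HellyProperty.exists_center`), and each closed half-plane through `p` contains at least `m` of the
points. By Birch's theorem a point of depth `m` of at least `3 m` points is in the hulls of `m`
disjoint parts (`DepthAtLeast.splitsAround`). This settles `h ≥ 4` with `m ≥ 3`, where
`h (m - 1) + 1 ≥ 3 m`, and gives `Tv(S, 2) ≤ h + 2`.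

For `h = 3` there are only `3 m - 2` points. Here `p` is chosen as an extreme point of the region of
deep points. It is one of the given points or a crossing of two segments between them
(`exists_crossing_of_mem_extremePoints`), and as `h = 3` such crossings belong to `S`. Splitting off
the singleton, or the two segments, lowers the depth by one, or two, and leaves `3 (m - 1)`, or
`3 (m - 2)`, points to which Birch's theorem applies. For `h ≤ 2` the set lies on a line, and a
median is used.

The Helly number of `ℤ²` is four by a parity argument
(`hellyProperty_of_exists_mem_openSegment`). The two values of `Tv(S, 2)` for `h = 4` are attained by
the vertices of a square, and by the vertices of a pentagon together with an inner point that lies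
on no diagonal.
-/

/-! ### Helly's property through independent sets -/

section Helly

variable {E : Type*} [AddCommGroup E] [Module ℝ E] {S : Set E} {k : ℕ}

theorem HellyProperty.mono {l : ℕ} (h : HellyProperty S k) (hkl : k ≤ l) : HellyProperty S l :=
  fun F hF hG => h F hF fun G hGF hGk => hG G hGF (hGk.trans hkl)

theorem not_hellyProperty_zero (hS : S.Nonempty) : ¬ HellyProperty S 0 := by
  intro h
  have := h {∅} (by simp [convex_empty]) (fun G _ hG => by
    have : G = ∅ := by simpa using hG
    simpa [this] using hS)
  simp at this

theorem exists_subset_card_le_image_eq {α β : Type*} [DecidableEq β] {f : α → β} {s : Finset α}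
    {t : Finset β} (h : t ⊆ s.image f) : ∃ u ⊆ s, u.card ≤ t.card ∧ u.image f = t := by
  classical
  obtain ⟨u, hus, hinj, rfl⟩ := Finset.exists_subset_injOn_image_eq_of_surjOn (f := f) s t
    (fun y hy => by simpa using h hy)
  exact ⟨u, by exact_mod_cast hus, (Finset.card_image_of_injOn hinj).ge, rfl⟩

/-- More than `k` points `T ⊆ S` are enough to force a common point of the hulls `conv (T \ {t})`:
any `k` of the hulls contain a further point of `T`. -/
theorem HellyProperty.exists_mem_forall_convexHull_diff (h : HellyProperty S k) {T : Finset E}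
    (hT : (T : Set E) ⊆ S) (hk : k < T.card) :
    ∃ p ∈ S, ∀ t ∈ T, p ∈ convexHull ℝ ((T : Set E) \ {t}) := by
  classical
  obtain ⟨p, hp, hpS⟩ := h (T.image fun t => convexHull ℝ ((T : Set E) \ {t}))
    (by
      intro C hC
      obtain ⟨t, -, rfl⟩ := Finset.mem_image.1 hC
      exact convex_convexHull ℝ _)
    (by
      intro G hG hGk
      obtain ⟨T', hT', hcard, rfl⟩ := exists_subset_card_le_image_eq hG
      obtain ⟨t, ht, htT'⟩ := Finset.exists_mem_notMem_of_card_lt_card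
        ((hcard.trans hGk).trans_lt hk)
      refine ⟨t, ?_, hT ht⟩
      simp only [Set.mem_sInter, Finset.mem_coe, Finset.mem_image]
      rintro _ ⟨s, hs, rfl⟩
      refine subset_convexHull ℝ _ ⟨ht, ?_⟩
      rintro rfl
      exact htT' hs)
  refine ⟨p, hpS, fun t ht => hp _ ?_⟩
  exact Finset.mem_coe.2 (Finset.mem_image_of_mem _ ht)

/-- Hoffman's criterion: only the families of hulls `conv (T \ {t})` have to be tested. -/
theorem hellyProperty_of_forall_exists_mem_convexHull_diff
    (h : ∀ T : Finset E, (T : Set E) ⊆ S → T.card = k + 1 →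
      ∃ p ∈ S, ∀ t ∈ T, p ∈ convexHull ℝ ((T : Set E) \ {t})) : HellyProperty S k := by
  classical
  -- families with `k + 1` members
  have key : ∀ F : Finset (Set E), (∀ C ∈ F, Convex ℝ C) → F.card = k + 1 →
      (∀ G : Finset (Set E), G ⊆ F → G.card ≤ k → (⋂₀ (G : Set (Set E)) ∩ S).Nonempty) →
      (⋂₀ (F : Set (Set E)) ∩ S).Nonempty := by
    intro F hF hcard hG
    have hch : ∀ C : Set E, ∃ t, C ∈ F → t ∈ S ∧ ∀ D ∈ F, D ≠ C → t ∈ D := by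
      intro C
      by_cases hC : C ∈ F
      · obtain ⟨t, ht, htS⟩ := hG (F.erase C) (Finset.erase_subset _ _)
          (by rw [Finset.card_erase_of_mem hC, hcard]; simp)
        exact ⟨t, fun _ => ⟨htS, fun D hD hDC => ht D (by simp [hD, hDC])⟩⟩
      · exact ⟨0, fun hC' => absurd hC' hC⟩
    choose t ht using hch
    by_cases hinj : Set.InjOn t F
    · obtain ⟨p, hpS, hp⟩ := h (F.image t)
        (by
          intro y hy
          obtain ⟨C, hC, rfl⟩ := Finset.mem_image.1 (Finset.mem_coe.1 hy)
          exact (ht C hC).1)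
        (by rw [Finset.card_image_of_injOn hinj, hcard])
      refine ⟨p, fun C hC => ?_, hpS⟩
      refine convexHull_min ?_ (hF C hC) (hp (t C) (Finset.mem_image_of_mem _ hC))
      rintro y ⟨hy, hyC⟩
      obtain ⟨D, hD, rfl⟩ := Finset.mem_image.1 (Finset.mem_coe.1 hy)
      refine (ht D hD).2 C hC ?_
      rintro rfl
      exact hyC rfl
    · simp only [Set.InjOn, not_forall] at hinj
      obtain ⟨C, hC, D, hD, hCD, hne⟩ := hinj
      refine ⟨t C, fun B hB => ?_, (ht C hC).1⟩
      by_cases hBC : B = C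
      · subst hBC
        rw [hCD]
        exact (ht D hD).2 B hB hne
      · exact (ht C hC).2 B hB hBC
  intro F
  induction hn : F.card using Nat.strong_induction_on generalizing F with
  | _ n ih =>
  intro hF hG
  rcases le_or_gt F.card k with hle | hlt
  · exact hG F subset_rfl hle
  rcases Nat.eq_or_lt_of_le hlt with heq | hlt'
  · exact key F hF heq.symm hG
  -- with more members, intersect all others with one fixed member
  have hG' : ∀ G : Finset (Set E), G ⊆ F → G.card ≤ k + 1 →
      (⋂₀ (G : Set (Set E)) ∩ S).Nonempty := by
    intro G hGF hGk
    rcases Nat.le_or_eq_of_le_succ hGk with h1 | h1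
    · exact hG G hGF h1
    · exact key G (fun C hC => hF C (hGF hC)) h1 fun G' hG' => hG G' (hG'.trans hGF)
  obtain ⟨C, hC⟩ : F.Nonempty := Finset.card_pos.1 (by omega)
  have hcl : ((F.erase C).image fun D => D ∩ C).card < n := by
    refine Finset.card_image_le.trans_lt ?_
    rw [Finset.card_erase_of_mem hC]
    omega
  obtain ⟨p, hp, hpS⟩ := ih _ hcl ((F.erase C).image fun D => D ∩ C) rfl
    (by
      intro B hB
      obtain ⟨D, hD, rfl⟩ := Finset.mem_image.1 hB
      exact (hF D (Finset.mem_of_mem_erase hD)).inter (hF C hC))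
    (by
      intro G hGF hGk
      obtain ⟨G', hG'F, hcard, rfl⟩ := exists_subset_card_le_image_eq hGF
      obtain ⟨p, hp, hpS⟩ := hG' (insert C G')
        (Finset.insert_subset hC (hG'F.trans (Finset.erase_subset _ _)))
        ((Finset.card_insert_le _ _).trans (by omega))
      refine ⟨p, ?_, hpS⟩
      intro B hB
      obtain ⟨D, hD, rfl⟩ := Finset.mem_image.1 (Finset.mem_coe.1 hB)
      exact ⟨hp D (by simp [hD]), hp C (by simp)⟩)
  obtain ⟨D, hD⟩ : (F.erase C).Nonempty :=
    Finset.card_pos.1 (by rw [Finset.card_erase_of_mem hC]; omega)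
  refine ⟨p, fun B hB => ?_, hpS⟩
  by_cases hBC : B = C
  · subst hBC
    exact (hp (D ∩ B) (Finset.mem_coe.2 (Finset.mem_image_of_mem _ hD))).2
  · exact (hp (B ∩ C) (Finset.mem_coe.2 (Finset.mem_image_of_mem (fun D => D ∩ C)
      (Finset.mem_erase.2 ⟨hBC, hB⟩)))).1

theorem exists_hellyNumber_eq (hS : S.Nonempty) (h : hellyNumber S < ⊤) :
    ∃ k : ℕ, hellyNumber S = k ∧ 0 < k ∧ HellyProperty S k ∧ ¬ HellyProperty S (k - 1) := by
  classical
  have hex : ∃ k, HellyProperty S k := by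
    by_contra hcon
    push Not at hcon
    refine h.ne ?_
    rw [hellyNumber, sInf_eq_top]
    rintro _ ⟨k, -, hk, -⟩
    exact absurd hk (hcon k)
  have hpos : 0 < Nat.find hex := by
    rw [Nat.find_pos]
    exact not_hellyProperty_zero hS
  refine ⟨Nat.find hex, le_antisymm ?_ ?_, hpos, Nat.find_spec hex,
    Nat.find_min hex (Nat.sub_lt hpos one_pos)⟩
  · exact sInf_le ⟨_, hpos, Nat.find_spec hex, rfl⟩
  · refine le_sInf ?_
    rintro _ ⟨k, -, hk, rfl⟩
    exact_mod_cast Nat.find_min' hex hk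

theorem hellyNumber_eq_succ (h : HellyProperty S (k + 1)) (h' : ¬ HellyProperty S k) :
    hellyNumber S = (k + 1 : ℕ) := by
  refine le_antisymm (sInf_le ⟨_, k.succ_pos, h, rfl⟩) (le_sInf ?_)
  rintro _ ⟨l, -, hl, rfl⟩
  by_contra! hlk
  exact h' (hl.mono (by exact_mod_cast Nat.lt_succ_iff.1 (by exact_mod_cast hlk)))

end Helly

/-! ### Tverberg numbers through coloured indexed families -/

section Tverberg

variable {E : Type*} [AddCommGroup E] [Module ℝ E] {S : Set E} {k m n : ℕ}

theorem exists_multiset_le_card_eq {α : Type*} {A : Multiset α} (h : n ≤ A.card) :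
    ∃ B ≤ A, B.card = n := by
  obtain ⟨B, hB⟩ : ∃ B, B ∈ A.powersetCard n := by
    rw [← Multiset.card_pos_iff_exists_mem, Multiset.card_powersetCard]
    exact Nat.choose_pos h
  exact ⟨B, Multiset.mem_powersetCard.1 hB⟩

/-- `m - 1` copies of each point of a set `T` whose hulls `conv (T \ {t})` do not meet in `S` have
no Tverberg partition into `m` parts: each `t ∈ T` is missing from some part. -/
theorem le_tverbergNumber (hm : 1 ≤ m) (h : ¬ HellyProperty S k) :
    (((k + 1) * (m - 1) + 1 : ℕ) : ℕ∞) ≤ tverbergNumber S m := by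
  classical
  obtain ⟨T, hTS, hcard, hT⟩ : ∃ T : Finset E, (T : Set E) ⊆ S ∧ T.card = k + 1 ∧
      ∀ p ∈ S, ∃ t ∈ T, p ∉ convexHull ℝ ((T : Set E) \ {t}) := by
    by_contra! hcon
    exact h (hellyProperty_of_forall_exists_mem_convexHull_diff hcon)
  refine le_sInf ?_
  rintro _ ⟨n, -, hn, rfl⟩
  by_contra! hlt
  have hlt' : n ≤ (k + 1) * (m - 1) := Nat.lt_succ_iff.1 (by exact_mod_cast hlt)
  obtain ⟨A, hA, hAn⟩ := exists_multiset_le_card_eq (A := (m - 1) • T.val) (n := n) (by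
    simp only [Multiset.card_nsmul, Finset.card_val, hcard]
    linarith)
  have hAT : ∀ y ∈ A, y ∈ T := fun y hy =>
    Multiset.mem_of_mem_nsmul (Multiset.mem_of_le hA hy)
  obtain ⟨B, hB, p, hpS, hp⟩ := hn A hAn fun y hy => hTS (hAT y hy)
  obtain ⟨t, ht, hpt⟩ := hT p hpS
  have hj : ∃ j, t ∉ B j := by
    by_contra! hcon
    have h1 : A.count t ≤ m - 1 := by
      refine (Multiset.le_iff_count.1 hA t).trans ?_
      rw [Multiset.count_nsmul]
      have := Multiset.nodup_iff_count_le_one.1 T.nodup t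
      nlinarith
    have h2 : m ≤ A.count t := by
      rw [← hB, Multiset.count_sum']
      calc m = ∑ _j : Fin m, 1 := by simp
        _ ≤ _ := Finset.sum_le_sum fun j _ => Multiset.one_le_count_iff_mem.2 (hcon j)
    omega
  obtain ⟨j, hj⟩ := hj
  refine hpt (convexHull_mono ?_ (hp j))
  intro y hy
  have hyA : y ∈ A := by
    rw [← hB]
    exact Multiset.mem_sum.2 ⟨j, Finset.mem_univ _, hy⟩
  refine ⟨hAT y hyA, ?_⟩
  rintro rfl
  exact hj hy

/-- The points `x i`, `i ∈ I`, can be coloured so that each of the first `m` colours has `p` in its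
convex hull. Colours are natural numbers, and those from `m` on are unused points. -/
def SplitsAround {ι : Type*} (x : ι → E) (I : Finset ι) (m : ℕ) (p : E) : Prop :=
  ∃ c : ι → ℕ, ∀ j < m, p ∈ convexHull ℝ (x '' {i | i ∈ I ∧ c i = j})

theorem tverbergNumber_le (hm : 1 ≤ m) (hn : 0 < n)
    (h : ∀ x : Fin n → E, (∀ i, x i ∈ S) → ∃ p ∈ S, SplitsAround x Finset.univ m p) :
    tverbergNumber S m ≤ n := by
  classical
  refine sInf_le ⟨n, hn, fun A hA hAS => ?_, rfl⟩
  obtain ⟨l, rfl⟩ := Quot.exists_rep A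
  obtain rfl : l.length = n := hA
  obtain ⟨p, hpS, c, hc⟩ := h l.get fun i => hAS _ (List.get_mem l i)
  let c' : Fin l.length → Fin m := fun i => if hi : c i < m then ⟨c i, hi⟩ else ⟨0, hm⟩
  refine ⟨fun j => ((Finset.univ.filter fun i => c' i = j).val.map l.get), ?_, p, hpS, ?_⟩
  · have h1 : ∑ j, (Finset.univ.filter fun i => c' i = j).val = Finset.univ.val := by
      have := Finset.sum_fiberwise (Finset.univ : Finset (Fin l.length)) c'
        (fun i => ({i} : Multiset (Fin l.length)))
      have h2 : ∀ s : Finset (Fin l.length), ∑ i ∈ s, ({i} : Multiset (Fin l.length)) = s.val :=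
        fun s => Finset.sum_multiset_singleton s
      simpa only [h2] using this
    have h3 := congrArg (Multiset.map l.get) h1
    rw [← Multiset.coe_mapAddMonoidHom, map_sum] at h3
    simpa [Fin.univ_val_map] using h3
  · intro j
    refine convexHull_mono ?_ (hc j j.2)
    rintro _ ⟨i, ⟨-, hi⟩, rfl⟩
    have : c' i = j := by
      apply Fin.ext
      simp [c', hi]
    simp only [Set.mem_ofPred_eq, Multiset.mem_map]
    exact ⟨i, by simp [this], rfl⟩

variable {ι : Type*} {x : ι → E} {I J : Finset ι} {p : E}

theorem SplitsAround.mono (h : SplitsAround x I m p) (hIJ : I ⊆ J) : SplitsAround x J m p := by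
  obtain ⟨c, hc⟩ := h
  exact ⟨c, fun j hj => convexHull_mono
    (Set.image_mono (fun _ hi => And.intro (hIJ hi.1) hi.2)) (hc j hj)⟩

theorem SplitsAround.of_le (h : SplitsAround x I m p) (hn : n ≤ m) : SplitsAround x I n p := by
  obtain ⟨c, hc⟩ := h
  exact ⟨c, fun j hj => hc j (hj.trans_le hn)⟩

theorem splitsAround_zero : SplitsAround x I 0 p :=
  ⟨0, fun j hj => absurd hj (by simp)⟩

theorem splitsAround_one (h : p ∈ convexHull ℝ (x '' I)) : SplitsAround x I 1 p := by
  refine ⟨0, fun j hj => ?_⟩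
  obtain rfl : j = 0 := by omega
  simpa using h

theorem SplitsAround.union [DecidableEq ι] (hI : SplitsAround x I m p) (hJ : SplitsAround x J n p)
    (hd : Disjoint I J) : SplitsAround x (I ∪ J) (m + n) p := by
  obtain ⟨c, hc⟩ := hI
  obtain ⟨d, hd'⟩ := hJ
  refine ⟨fun i => if i ∈ I then if c i < m then c i else m + n else m + d i, fun j hj => ?_⟩
  rcases lt_or_ge j m with h | h
  · refine convexHull_mono (Set.image_mono ?_) (hc j h)
    rintro i ⟨hi, rfl⟩
    simp [hi, h]
  · refine convexHull_mono (Set.image_mono ?_) (hd' (j - m) (by omega))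
    rintro i ⟨hi, hij⟩
    have : i ∉ I := fun hi' => Finset.disjoint_left.1 hd hi' hi
    simp [hi, this]
    omega

theorem splitsAround_card (h : ∀ i ∈ I, x i = p) : SplitsAround x I I.card p := by
  classical
  induction I using Finset.induction_on with
  | empty => exact splitsAround_zero
  | insert i I hi ih =>
    rw [Finset.card_insert_of_notMem hi, add_comm, Finset.insert_eq]
    refine (splitsAround_one ?_).union (ih fun j hj => h j (by simp [hj])) (by simpa using hi)
    simp [h i (by simp)]

/-- Two sets of indices are matched into pairs, each pair having `p` on its segment. -/
theorem splitsAround_of_pairs [DecidableEq ι] (hI : m ≤ I.card) (hJ : m ≤ J.card)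
    (hd : Disjoint I J) (h : ∀ i ∈ I, ∀ j ∈ J, p ∈ segment ℝ (x i) (x j)) :
    SplitsAround x (I ∪ J) m p := by
  induction m generalizing I J with
  | zero => exact splitsAround_zero
  | succ m ih =>
    obtain ⟨i, hi⟩ : I.Nonempty := Finset.card_pos.1 (by omega)
    obtain ⟨j, hj⟩ : J.Nonempty := Finset.card_pos.1 (by omega)
    have h1 := ih (I := I.erase i) (J := J.erase j)
      (by rw [Finset.card_erase_of_mem hi]; omega) (by rw [Finset.card_erase_of_mem hj]; omega)
      (hd.mono (Finset.erase_subset _ _) (Finset.erase_subset _ _))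
      fun a ha b hb => h a (Finset.mem_of_mem_erase ha) b (Finset.mem_of_mem_erase hb)
    have h2 : SplitsAround x {i, j} 1 p := splitsAround_one (by
      simpa [Set.image_pair, convexHull_pair] using h i hi j hj)
    refine (h1.union h2 ?_).mono ?_
    · rw [Finset.disjoint_left] at hd ⊢
      simp only [Finset.mem_union, Finset.mem_erase, Finset.mem_insert, Finset.mem_singleton]
      rintro a (⟨ha, haI⟩ | ⟨ha, haJ⟩) (rfl | rfl)
      · exact ha rfl
      · exact hd haI hj
      · exact hd hi haJ
      · exact ha rfl
    · intro a
      simp only [Finset.mem_union, Finset.mem_erase, Finset.mem_insert, Finset.mem_singleton]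
      rintro ((⟨-, ha⟩ | ⟨-, ha⟩) | (rfl | rfl)) <;> tauto

end Tverberg

/-! ### Depth of a point in a finite family -/

section Depth

variable {E : Type*} [AddCommGroup E] [Module ℝ E] {S : Set E} {ι : Type*} {x : ι → E}
  {I J : Finset ι} {p : E} {k m : ℕ}

open Classical in
/-- Tukey depth: each closed half-space through `p` contains at least `m` of the points `x i`,
`i ∈ I`. The zero functional is allowed; for it the condition says `m ≤ #I`. -/
def DepthAtLeast (x : ι → E) (I : Finset ι) (p : E) (m : ℕ) : Prop :=
  ∀ f : E →ₗ[ℝ] ℝ, m ≤ (I.filter fun i => f p ≤ f (x i)).card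

theorem DepthAtLeast.sdiff [DecidableEq ι] (h : DepthAtLeast x I p m) (J : Finset ι) :
    DepthAtLeast x (I \ J) p (m - J.card) := by
  classical
  intro f
  have h1 : (I.filter fun i => f p ≤ f (x i)) ⊆ ((I \ J).filter fun i => f p ≤ f (x i)) ∪ J := by
    intro i
    simp only [Finset.mem_filter, Finset.mem_union, Finset.mem_sdiff]
    tauto
  have h2 := (Finset.card_le_card h1).trans (Finset.card_union_le _ _)
  have h3 : m ≤ (I.filter fun i => f p ≤ f (x i)).card := by convert h f
  convert Nat.sub_le_of_le_add (h3.trans h2)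

/-- A functional that is larger at `p` than at all points is larger than on their hull. -/
theorem exists_le_of_mem_convexHull {s : Set E} (hp : p ∈ convexHull ℝ s) (f : E →ₗ[ℝ] ℝ) :
    ∃ y ∈ s, f p ≤ f y := by
  by_contra! hcon
  have : convexHull ℝ s ⊆ {y | f y < f p} :=
    convexHull_min hcon (convex_halfSpace_lt f.isLinear _)
  exact lt_irrefl (f p) (this hp)

theorem depthAtLeast_of_forall_mem_convexHull
    (h : ∀ J ⊆ I, I.card < J.card + m → p ∈ convexHull ℝ (x '' J)) : DepthAtLeast x I p m := by
  classical
  intro f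
  by_contra! hlt
  have hc := Finset.card_filter_add_card_filter_not (s := I) (fun i => f p ≤ f (x i))
  obtain ⟨_, ⟨i, hi, rfl⟩, hle⟩ := exists_le_of_mem_convexHull
    (h (I.filter fun i => ¬ f p ≤ f (x i)) (Finset.filter_subset _ _) (by
      have : (I.filter fun i => f p ≤ f (x i)).card < m := by convert hlt
      omega)) f
  exact (Finset.mem_filter.1 (Finset.mem_coe.1 hi)).2 hle

/-- The centerpoint theorem for `S`: any `k` sets that miss at most `m - 1` of the points each
have a point in common, hence their hulls all meet in one point of `S`. -/
theorem HellyProperty.exists_center (h : HellyProperty S k) (hx : ∀ i ∈ I, x i ∈ S)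
    (hI : k * (m - 1) < I.card) :
    ∃ p ∈ S, ∀ J ⊆ I, I.card < J.card + m → p ∈ convexHull ℝ (x '' J) := by
  classical
  obtain ⟨p, hp, hpS⟩ := h
    ((I.powerset.filter fun J => I.card < J.card + m).image fun J : Finset ι =>
      convexHull ℝ (x '' (J : Set ι)))
    (by
      intro C hC
      obtain ⟨J, -, rfl⟩ := Finset.mem_image.1 hC
      exact convex_convexHull ℝ _)
    (by
      intro G hG hGk
      obtain ⟨K, hK, hcard, rfl⟩ := exists_subset_card_le_image_eq hG
      obtain ⟨i, hi, hiK⟩ : ∃ i ∈ I, i ∉ K.biUnion fun J => I \ J := by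
        refine Finset.exists_mem_notMem_of_card_lt_card ?_
        refine (Finset.card_biUnion_le_card_mul _ _ (m - 1) ?_).trans_lt
          ((Nat.mul_le_mul_right _ (hcard.trans hGk)).trans_lt hI)
        intro J hJ
        have hJ' := Finset.mem_filter.1 (hK hJ)
        rw [Finset.card_sdiff_of_subset (Finset.mem_powerset.1 hJ'.1)]
        omega
      refine ⟨x i, ?_, hx i hi⟩
      intro C hC
      obtain ⟨J, hJ, rfl⟩ := Finset.mem_image.1 (Finset.mem_coe.1 hC)
      refine subset_convexHull ℝ _ ⟨i, ?_, rfl⟩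
      by_contra hiJ
      exact hiK (Finset.mem_biUnion.2 ⟨J, hJ, Finset.mem_sdiff.2 ⟨hi, hiJ⟩⟩))
  refine ⟨p, hpS, fun J hJ hJm => hp _ ?_⟩
  exact Finset.mem_coe.2 (Finset.mem_image_of_mem
    (fun J : Finset ι => convexHull ℝ (x '' (J : Set ι)))
    (Finset.mem_filter.2 ⟨Finset.mem_powerset.2 hJ, hJm⟩))

end Depth

/-! ### Splitting a family in the plane around a deep point -/

section Plane

/-- The Euclidean plane. -/
abbrev Plane : Type := EuclideanSpace ℝ (Fin 2)

variable {ι : Type*} {x : ι → Plane} {I : Finset ι} {p : Plane} {m : ℕ}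

theorem linearMap_plane_apply (f : Plane →ₗ[ℝ] ℝ) (v : Plane) :
    f v = f !₂[1, 0] * v 0 + f !₂[0, 1] * v 1 := by
  have : v = v 0 • !₂[1, 0] + v 1 • !₂[0, 1] := by
    ext i
    fin_cases i <;> simp
  conv_lhs => rw [this]
  simp only [map_add, map_smul, smul_eq_mul]
  ring

/-- If more than `3 m` points have depth `m`, some point can be dropped: otherwise each point lies
in a closed half-plane with exactly `m` points, and three (or even two) of these half-planes contain
all the points. -/
theorem DepthAtLeast.exists_erase [DecidableEq ι] (h : DepthAtLeast x I p m)
    (hI : 3 * m < I.card) : ∃ i ∈ I, DepthAtLeast x (I.erase i) p m := by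
  classical
  by_contra! hcon
  have hch : ∀ i, ∃ ab : ℝ × ℝ, i ∈ I →
      (I.filter fun j => 0 ≤ ab.1 * (x j - p) 0 + ab.2 * (x j - p) 1).card ≤ m ∧
        0 ≤ ab.1 * (x i - p) 0 + ab.2 * (x i - p) 1 := by
    intro i
    by_cases hi : i ∈ I
    · have := hcon i hi
      simp only [DepthAtLeast, not_forall, not_le] at this
      obtain ⟨f, hf⟩ := this
      have hiff : ∀ j, (f p ≤ f (x j) ↔
          0 ≤ f !₂[1, 0] * (x j - p) 0 + f !₂[0, 1] * (x j - p) 1) := by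
        intro j
        rw [← linearMap_plane_apply, map_sub, sub_nonneg]
      refine ⟨(f !₂[1, 0], f !₂[0, 1]), fun _ => ?_⟩
      simp only [← hiff]
      have hf' : ((I.erase i).filter fun j => f p ≤ f (x j)).card < m := by convert hf
      rw [Finset.filter_erase] at hf'
      have hle := Finset.pred_card_le_card_erase (s := I.filter fun j => f p ≤ f (x j)) (a := i)
      constructor
      · omega
      · by_contra hnot
        rw [Finset.erase_eq_of_notMem (by simp [hnot])] at hf'
        have h1 := h f
        have : m ≤ (I.filter fun j => f p ≤ f (x j)).card := by convert h1
        omega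
    · exact ⟨0, fun hi' => absurd hi' hi⟩
  choose a ha using hch
  by_cases h0 : (0 : ℝ × ℝ) ∈ convexHull ℝ (a '' I)
  · obtain ⟨κ, _, z, w, hz, hind, hw, hw1, hsum⟩ := eq_pos_convex_span_of_mem_convexHull h0
    have hκ : Fintype.card κ ≤ 3 := by
      have h1 := hind.card_le_finrank_succ
      have h2 := Submodule.finrank_le (vectorSpan ℝ (Set.range z))
      rw [Module.finrank_prod, Module.finrank_self] at h2
      omega
    have hcov : I ⊆ (Finset.univ : Finset κ).biUnion fun l =>
        I.filter fun j => 0 ≤ (z l).1 * (x j - p) 0 + (z l).2 * (x j - p) 1 := by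
      intro j hj
      by_contra hj'
      simp only [Finset.mem_biUnion, Finset.mem_univ, true_and, Finset.mem_filter, hj, not_exists,
        not_le] at hj'
      have h1 : ∑ l, w l * ((z l).1 * (x j - p) 0 + (z l).2 * (x j - p) 1) = 0 := by
        have e1 := congrArg Prod.fst hsum
        have e2 := congrArg Prod.snd hsum
        simp only [Prod.fst_sum, Prod.snd_sum, Prod.smul_fst, Prod.smul_snd, smul_eq_mul,
          Prod.fst_zero, Prod.snd_zero] at e1 e2
        simp only [mul_add, Finset.sum_add_distrib, ← mul_assoc, ← Finset.sum_mul, e1, e2]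
        simp
      have hne : (Finset.univ : Finset κ).Nonempty := by
        rw [Finset.univ_nonempty_iff]
        by_contra hemp
        rw [not_nonempty_iff] at hemp
        simp at hw1
      exact absurd h1 (Finset.sum_neg (fun l _ => mul_neg_of_pos_of_neg (hw l) (hj' l)) hne).ne
    have h1 := (Finset.card_le_card hcov).trans (Finset.card_biUnion_le_card_mul _ _ m (by
      intro l _
      obtain ⟨i, hi, hil⟩ := hz ⟨l, rfl⟩
      rw [← hil]
      exact (ha i hi).1))
    rw [Finset.card_univ] at h1
    have : Fintype.card κ * m ≤ 3 * m := Nat.mul_le_mul_right _ hκ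
    omega
  · obtain ⟨g, u, hgu, hg⟩ := geometric_hahn_banach_point_closed (convex_convexHull ℝ (a '' I))
      ((I.finite_toSet.image a).isClosed_convexHull ℝ) h0
    obtain ⟨s, hs⟩ : ∃ s, s = g (1, 0) := ⟨_, rfl⟩
    obtain ⟨t, ht⟩ : ∃ t, t = g (0, 1) := ⟨_, rfl⟩
    have hpos : ∀ i ∈ I, 0 < s * (a i).1 + t * (a i).2 := by
      intro i hi
      have h1 := hg (a i) (subset_convexHull ℝ _ ⟨i, hi, rfl⟩)
      have h2 : a i = (a i).1 • ((1, 0) : ℝ × ℝ) + (a i).2 • ((0, 1) : ℝ × ℝ) := by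
        ext <;> simp
      rw [h2, map_add, map_smul, map_smul, ← hs, ← ht, smul_eq_mul, smul_eq_mul] at h1
      rw [map_zero] at hgu
      linarith
    have hne : I.Nonempty := Finset.card_pos.1 (by omega)
    -- the functionals lie in an open half-plane; the two extreme ones are enough
    let r : ι → ℝ := fun i => (-t * (a i).1 + s * (a i).2) / (s * (a i).1 + t * (a i).2)
    obtain ⟨i₁, hi₁, hmax⟩ := Finset.exists_max_image I r hne
    obtain ⟨i₂, hi₂, hmin⟩ := Finset.exists_min_image I r hne
    have hD : 0 < s ^ 2 + t ^ 2 := by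
      obtain ⟨i, hi⟩ := hne
      have := hpos i hi
      by_contra hcon
      have hs0 : s = 0 := by nlinarith [sq_nonneg s, sq_nonneg t]
      have ht0 : t = 0 := by nlinarith [sq_nonneg s, sq_nonneg t]
      simp [hs0, ht0] at this
    have hiff : ∀ i ∈ I, ∀ v : Plane, (0 ≤ (a i).1 * v 0 + (a i).2 * v 1 ↔
        0 ≤ (s * v 0 + t * v 1) + r i * (-t * v 0 + s * v 1)) := by
      intro i hi v
      have hi' := hpos i hi
      have : (s * v 0 + t * v 1) + r i * (-t * v 0 + s * v 1) =
          ((s ^ 2 + t ^ 2) / (s * (a i).1 + t * (a i).2)) *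
            ((a i).1 * v 0 + (a i).2 * v 1) := by
        simp only [r]
        field_simp
        ring
      rw [this, mul_nonneg_iff_of_pos_left (by positivity)]
    have hcov : I ⊆ (I.filter fun j => 0 ≤ (a i₁).1 * (x j - p) 0 + (a i₁).2 * (x j - p) 1) ∪
        (I.filter fun j => 0 ≤ (a i₂).1 * (x j - p) 0 + (a i₂).2 * (x j - p) 1) := by
      intro j hj
      have h1 := (hiff j hj (x j - p)).1 (ha j hj).2
      simp only [Finset.mem_union, Finset.mem_filter, hj, true_and]
      rw [hiff i₁ hi₁, hiff i₂ hi₂]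
      rcases le_total 0 (-t * (x j - p) 0 + s * (x j - p) 1) with hq | hq
      · left
        nlinarith [mul_le_mul_of_nonneg_right (hmax j hj) hq]
      · right
        nlinarith [mul_le_mul_of_nonpos_right (hmin j hj) hq]
    have h1 := (Finset.card_le_card hcov).trans (Finset.card_union_le _ _)
    have h2 := (ha i₁ hi₁).1
    have h3 := (ha i₂ hi₂).1
    omega

theorem DepthAtLeast.exists_subset_card_eq (h : DepthAtLeast x I p m) (hI : 3 * m ≤ I.card) :
    ∃ J ⊆ I, J.card = 3 * m ∧ DepthAtLeast x J p m := by
  classical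
  induction hn : I.card generalizing I with
  | zero => exact ⟨I, subset_rfl, by omega, h⟩
  | succ n ih =>
    rcases Nat.eq_or_lt_of_le hI with heq | hlt
    · exact ⟨I, subset_rfl, heq.symm, h⟩
    · obtain ⟨i, hi, hd⟩ := h.exists_erase hlt
      have hc := Finset.card_erase_of_mem hi
      obtain ⟨J, hJ, hJ'⟩ := ih hd (by omega) (by omega)
      exact ⟨J, hJ.trans (Finset.erase_subset _ _), hJ'⟩

/-- Inside `(-π, π]`, an open half-circle of directions is an interval, or its complement is. -/
theorem cos_sub_interval {φ : ℝ} (hφ : φ ∈ Set.Ioc (-Real.pi) Real.pi) :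
    (∀ θ₁ ∈ Set.Ioc (-Real.pi) Real.pi, ∀ θ₂ ∈ Set.Ioc (-Real.pi) Real.pi,
      ∀ θ ∈ Set.Icc θ₁ θ₂, 0 < Real.cos (θ₁ - φ) → 0 < Real.cos (θ₂ - φ) → 0 < Real.cos (θ - φ)) ∨
    (∀ θ₁ ∈ Set.Ioc (-Real.pi) Real.pi, ∀ θ₂ ∈ Set.Ioc (-Real.pi) Real.pi,
      ∀ θ ∈ Set.Icc θ₁ θ₂, Real.cos (θ₁ - φ) ≤ 0 → Real.cos (θ₂ - φ) ≤ 0 →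
        Real.cos (θ - φ) ≤ 0) := by
  have hπ := Real.pi_pos
  obtain ⟨hφ1, hφ2⟩ := hφ
  rcases lt_or_ge φ (-(Real.pi / 2)) with h1 | h1
  · right
    have key : ∀ θ ∈ Set.Ioc (-Real.pi) Real.pi, Real.cos (θ - φ) ≤ 0 →
        Real.pi / 2 ≤ θ - φ ∧ θ - φ ≤ Real.pi + Real.pi / 2 := by
      rintro θ ⟨hθ1, hθ2⟩ hc
      constructor
      · by_contra! hcon
        exact absurd (Real.cos_pos_of_mem_Ioo ⟨by linarith, hcon⟩) hc.not_gt
      · by_contra! hcon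
        rw [← Real.cos_sub_two_pi] at hc
        exact absurd (Real.cos_pos_of_mem_Ioo ⟨by linarith, by linarith⟩) hc.not_gt
    rintro θ₁ hθ₁ θ₂ hθ₂ θ ⟨hl, hr⟩ hc1 hc2
    exact Real.cos_nonpos_of_pi_div_two_le_of_le (by linarith [(key θ₁ hθ₁ hc1).1])
      (by linarith [(key θ₂ hθ₂ hc2).2])
  rcases le_or_gt φ (Real.pi / 2) with h2 | h2
  · left
    have key : ∀ θ ∈ Set.Ioc (-Real.pi) Real.pi, 0 < Real.cos (θ - φ) →
        -(Real.pi / 2) < θ - φ ∧ θ - φ < Real.pi / 2 := by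
      rintro θ ⟨hθ1, hθ2⟩ hc
      constructor
      · by_contra! hcon
        rw [← Real.cos_neg] at hc
        exact absurd hc (Real.cos_nonpos_of_pi_div_two_le_of_le (by linarith)
          (by linarith)).not_gt
      · by_contra! hcon
        exact absurd hc (Real.cos_nonpos_of_pi_div_two_le_of_le (by linarith)
          (by linarith)).not_gt
    rintro θ₁ hθ₁ θ₂ hθ₂ θ ⟨hl, hr⟩ hc1 hc2
    exact Real.cos_pos_of_mem_Ioo ⟨by linarith [(key θ₁ hθ₁ hc1).1],
      by linarith [(key θ₂ hθ₂ hc2).2]⟩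
  · right
    have key : ∀ θ ∈ Set.Ioc (-Real.pi) Real.pi, Real.cos (θ - φ) ≤ 0 →
        Real.pi / 2 ≤ -(θ - φ) ∧ -(θ - φ) ≤ Real.pi + Real.pi / 2 := by
      rintro θ ⟨hθ1, hθ2⟩ hc
      constructor
      · by_contra! hcon
        exact absurd (Real.cos_pos_of_mem_Ioo ⟨by linarith, by linarith⟩) hc.not_gt
      · by_contra! hcon
        rw [← Real.cos_add_two_pi] at hc
        exact absurd (Real.cos_pos_of_mem_Ioo ⟨by linarith, by linarith⟩) hc.not_gt
    rintro θ₁ hθ₁ θ₂ hθ₂ θ ⟨hl, hr⟩ hc1 hc2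
    rw [← Real.cos_neg]
    exact Real.cos_nonpos_of_pi_div_two_le_of_le (by linarith [(key θ₂ hθ₂ hc2).1])
      (by linarith [(key θ₁ hθ₁ hc1).2])

/-- The polar angle of `v`, in `(-π, π]`. -/
noncomputable def planeArg (v : Plane) : ℝ := Complex.arg ⟨v 0, v 1⟩

theorem planeArg_mem (v : Plane) : planeArg v ∈ Set.Ioc (-Real.pi) Real.pi :=
  Complex.arg_mem_Ioc _

theorem exists_linearMap_pos_iff_cos (f : Plane →ₗ[ℝ] ℝ) (hf : f ≠ 0) :
    ∃ φ ∈ Set.Ioc (-Real.pi) Real.pi, ∀ v : Plane, v ≠ 0 →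
      (0 < f v ↔ 0 < Real.cos (planeArg v - φ)) := by
  let w : ℂ := ⟨f !₂[1, 0], f !₂[0, 1]⟩
  refine ⟨w.arg, Complex.arg_mem_Ioc _, fun v hv => ?_⟩
  let z : ℂ := ⟨v 0, v 1⟩
  have hw : 0 < ‖w‖ := by
    rw [norm_pos_iff]
    intro hw0
    refine hf (LinearMap.ext fun u => ?_)
    have e1 : f !₂[1, 0] = 0 := congrArg Complex.re hw0
    have e2 : f !₂[0, 1] = 0 := congrArg Complex.im hw0
    rw [linearMap_plane_apply, e1, e2]
    simp
  have hz : 0 < ‖z‖ := by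
    rw [norm_pos_iff]
    intro hz0
    refine hv ?_
    have e1 : v 0 = 0 := congrArg Complex.re hz0
    have e2 : v 1 = 0 := congrArg Complex.im hz0
    ext i
    fin_cases i <;> simp [e1, e2]
  have hfv : f v = (‖w‖ * ‖z‖) * Real.cos (planeArg v - w.arg) := by
    have e1 : ‖w‖ * Real.cos w.arg = f !₂[1, 0] := Complex.norm_mul_cos_arg w
    have e2 : ‖w‖ * Real.sin w.arg = f !₂[0, 1] := Complex.norm_mul_sin_arg w
    have e3 : ‖z‖ * Real.cos (planeArg v) = v 0 := Complex.norm_mul_cos_arg z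
    have e4 : ‖z‖ * Real.sin (planeArg v) = v 1 := Complex.norm_mul_sin_arg z
    rw [linearMap_plane_apply, Real.cos_sub, ← e1, ← e2, ← e3, ← e4]
    ring
  rw [hfv, mul_pos_iff_of_pos_left (mul_pos hw hz)]

/-- Three indices at cyclic distance `m` in `Fin (3 * m)` cut the others into gaps of fewer than `m`
indices. -/
theorem card_lt_of_interval (Q : Fin (3 * m) → Prop) [DecidablePred Q]
    (hQ : (∀ a b c, a ≤ b → b ≤ c → ¬ Q a → ¬ Q c → ¬ Q b) ∨
      (∀ a b c, a ≤ b → b ≤ c → Q a → Q c → Q b))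
    {a b c : Fin (3 * m)} (hab : (b : ℕ) = a + m) (hbc : (c : ℕ) = b + m)
    (ha : ¬ Q a) (hb : ¬ Q b) (hc : ¬ Q c) :
    (Finset.univ.filter Q).card < m := by
  have hcl := c.2
  have key : ∀ s : Finset ℕ, s.card < m → (∀ t, Q t → (t : ℕ) ∈ s) →
      (Finset.univ.filter Q).card < m := by
    intro s hs h
    refine lt_of_le_of_lt ?_ hs
    exact Finset.card_le_card_of_injOn (fun t => (t : ℕ)) (fun t ht => h t (by simpa using ht))
      (fun _ _ _ _ hij => Fin.ext hij)
  rcases hQ with hQ | hQ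
  · refine key (Finset.range (3 * m) \ Finset.Icc (a : ℕ) c) ?_ ?_
    · rw [Finset.card_sdiff_of_subset, Finset.card_range, Nat.card_Icc]
      · omega
      · intro t
        simp only [Finset.mem_Icc, Finset.mem_range]
        omega
    · intro t ht
      simp only [Finset.mem_sdiff, Finset.mem_range, t.2, true_and, Finset.mem_Icc]
      rintro ⟨h1, h2⟩
      exact hQ a t c h1 h2 ha hc ht
  · by_cases hex : ∃ t, Q t
    swap
    · exact key ∅ (by simp; omega) fun t ht => absurd ⟨t, ht⟩ hex
    obtain ⟨t₀, ht₀⟩ := hex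
    have hne : ∀ d, ¬ Q d → ∀ t, Q t → (t < d ↔ t₀ < d) := by
      intro d hd t ht
      constructor
      · intro h1
        by_contra! h2
        exact hd (hQ t d t₀ h1.le h2 ht ht₀)
      · intro h1
        by_contra! h2
        exact hd (hQ t₀ d t h1.le h2 ht₀ ht)
    have hne' : ∀ d, ¬ Q d → ∀ t, Q t → (t : ℕ) ≠ d := by
      intro d hd t ht h
      exact hd (Fin.ext h ▸ ht)
    simp only [Fin.lt_def] at hne
    rcases lt_or_ge t₀ a with h1 | h1
    · refine key (Finset.range a) (by simp; omega) fun t ht => ?_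
      simp only [Finset.mem_range]
      exact (hne a ha t ht).2 h1
    rcases lt_or_ge t₀ b with h2 | h2
    · refine key (Finset.Ioo a b) (by simp; omega) fun t ht => ?_
      have e1 := hne a ha t ht
      have e2 := hne b hb t ht
      have e3 := hne' a ha t ht
      simp only [Fin.lt_def, Fin.le_def, Finset.mem_Ioo] at *
      omega
    rcases lt_or_ge t₀ c with h3 | h3
    · refine key (Finset.Ioo b c) (by simp; omega) fun t ht => ?_
      have e1 := hne b hb t ht
      have e2 := hne c hc t ht
      have e3 := hne' b hb t ht
      simp only [Fin.lt_def, Fin.le_def, Finset.mem_Ioo] at *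
      omega
    · refine key (Finset.Ioo (c : ℕ) (3 * m)) (by simp; omega) fun t ht => ?_
      have e2 := hne c hc t ht
      have e3 := hne' c hc t ht
      have e4 := t.2
      simp only [Fin.le_def, Finset.mem_Ioo] at *
      omega

/-- Birch's theorem for exactly `3 m` points: sort them by angle around `p` and take the triangles
of points at distance `m` in the cyclic order. A triangle missing `p` lies in an open half-plane,
and the opposite closed half-plane is contained in one of its gaps. -/
theorem DepthAtLeast.splitsAround_of_card_eq (h : DepthAtLeast x I p m) (hI : I.card = 3 * m)
    (hp : ∀ i ∈ I, x i ≠ p) : SplitsAround x I m p := by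
  classical
  let e₀ : I ≃ Fin (3 * m) := I.equivFinOfCardEq hI
  let θ : Fin (3 * m) → ℝ := fun t => planeArg (x (e₀.symm t) - p)
  let e : Fin (3 * m) ≃ I := (Tuple.sort θ).trans e₀.symm
  have hmono : Monotone fun t => planeArg (x (e t) - p) := Tuple.monotone_sort θ
  refine ⟨fun i => if hi : i ∈ I then (e.symm ⟨i, hi⟩ : ℕ) % m else 0, fun j hj => ?_⟩
  by_contra hcon
  obtain ⟨g, u, hgu, hg⟩ := geometric_hahn_banach_point_closed (convex_convexHull ℝ _)
    (((I.finite_toSet.subset fun _ => And.left).image x).isClosed_convexHull ℝ) hcon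
  have hpos : ∀ t : Fin (3 * m), (t : ℕ) % m = j → 0 < g (x (e t) - p) := by
    intro t ht
    have := hg (x (e t)) (subset_convexHull ℝ _ ⟨e t, ⟨(e t).2, by simp [ht]⟩, rfl⟩)
    rw [map_sub]
    linarith
  let a : Fin (3 * m) := ⟨j, by omega⟩
  let b : Fin (3 * m) := ⟨j + m, by omega⟩
  let c : Fin (3 * m) := ⟨j + m + m, by omega⟩
  have ha := hpos a (Nat.mod_eq_of_lt hj)
  have hb := hpos b (by simp [b, Nat.mod_eq_of_lt hj])
  have hc := hpos c (by simp [c, Nat.mod_eq_of_lt hj])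
  obtain ⟨φ, hφ, hcos⟩ := exists_linearMap_pos_iff_cos g.toLinearMap (by
    intro h0
    have := LinearMap.congr_fun h0 (x (e a) - p)
    simp only [ContinuousLinearMap.coe_coe, LinearMap.zero_apply] at this
    linarith)
  have hcos' : ∀ t : Fin (3 * m),
      (0 < g (x (e t) - p) ↔ 0 < Real.cos (planeArg (x (e t) - p) - φ)) :=
    fun t => hcos _ (sub_ne_zero.2 (hp _ (e t).2))
  have hlt := card_lt_of_interval (fun t => g (x (e t) - p) ≤ 0) (by
    rcases cos_sub_interval hφ with hcase | hcase
    · left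
      intro t₁ t t₂ h1 h2
      simp only [not_le, hcos']
      exact hcase _ (planeArg_mem _) _ (planeArg_mem _) _ ⟨hmono h1, hmono h2⟩
    · right
      intro t₁ t t₂ h1 h2
      simp only [← not_lt, hcos']
      simp only [not_lt]
      exact hcase _ (planeArg_mem _) _ (planeArg_mem _) _ ⟨hmono h1, hmono h2⟩)
    (a := a) (b := b) (c := c) rfl rfl (not_le.2 ha) (not_le.2 hb) (not_le.2 hc)
  have hm := h (-g.toLinearMap)
  refine absurd (hm.trans (Finset.card_le_card_of_surjOn (fun t => (e t : ι)) ?_)) hlt.not_ge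
  intro i hi
  simp only [Finset.coe_filter, Set.mem_ofPred_eq, LinearMap.neg_apply, neg_le_neg_iff,
    ContinuousLinearMap.coe_coe] at hi
  refine ⟨e.symm ⟨i, hi.1⟩, ?_, by simp⟩
  simpa using hi.2

/-- Birch's theorem: `m` parts around a point of depth `m` of at least `3 m` points. -/
theorem DepthAtLeast.splitsAround (h : DepthAtLeast x I p m) (hI : 3 * m ≤ I.card) :
    SplitsAround x I m p := by
  classical
  let I₀ := I.filter fun i => x i = p
  have h₀ : SplitsAround x I₀ I₀.card p :=
    splitsAround_card fun i hi => (Finset.mem_filter.1 hi).2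
  rcases le_or_gt m I₀.card with hle | hlt
  · exact (h₀.of_le hle).mono (Finset.filter_subset _ _)
  have hc : (I \ I₀).card = I.card - I₀.card :=
    Finset.card_sdiff_of_subset (Finset.filter_subset _ _)
  obtain ⟨J, hJ, hJc, hJd⟩ := (h.sdiff I₀).exists_subset_card_eq (by omega)
  have h₁ := hJd.splitsAround_of_card_eq hJc fun i hi => by
    have := hJ hi
    simp only [I₀, Finset.mem_sdiff, Finset.mem_filter] at this
    tauto
  refine ((h₀.union h₁ ?_).of_le (by omega)).mono ?_
  · exact Finset.disjoint_of_subset_right hJ Finset.disjoint_sdiff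
  · exact Finset.union_subset (Finset.filter_subset _ _) (hJ.trans Finset.sdiff_subset)

end Plane

/-! ### Extreme points of the region of deep points -/

section Crossing

open Filter Topology

variable {S : Set Plane} {ι : Type*} {x : ι → Plane} {I : Finset ι} {a b c d p : Plane} {m : ℕ}

/-- The functional `v ↦ det (u, v)`. -/
noncomputable def crossMap (u : Plane) : Plane →ₗ[ℝ] ℝ where
  toFun v := u 0 * v 1 - u 1 * v 0
  map_add' v w := by simp; ring
  map_smul' r v := by simp; ring

theorem crossMap_apply (u v : Plane) : crossMap u v = u 0 * v 1 - u 1 * v 0 := rfl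

theorem crossMap_self (u : Plane) : crossMap u u = 0 := by
  rw [crossMap_apply]; ring

theorem crossMap_swap (u v : Plane) : crossMap v u = -crossMap u v := by
  simp only [crossMap_apply]; ring

theorem exists_smul_eq_of_crossMap_eq_zero {u v : Plane} (hu : u ≠ 0) (h : crossMap u v = 0) :
    ∃ r : ℝ, v = r • u := by
  rw [crossMap_apply] at h
  by_cases h0 : u 0 = 0
  · have h1 : u 1 ≠ 0 := by
      intro h1
      refine hu ?_
      ext i
      fin_cases i <;> simp [h0, h1]
    refine ⟨v 1 / u 1, ?_⟩
    have : v 0 = 0 := by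
      rw [h0] at h
      simpa [h1] using h
    ext i
    fin_cases i
    · simp [h0, this]
    · simp [h1]
  · refine ⟨v 0 / u 0, ?_⟩
    ext i
    fin_cases i
    · simp [h0]
    · simp
      field_simp
      linarith

theorem eq_of_crossMap_sub_eq_zero {u v q : Plane} (h : crossMap u v ≠ 0)
    (hu : crossMap u (q - p) = 0) (hv : crossMap v (q - p) = 0) : q = p := by
  rw [← sub_eq_zero]
  by_contra hne
  rw [crossMap_swap, neg_eq_zero] at hu hv
  obtain ⟨r, rfl⟩ := exists_smul_eq_of_crossMap_eq_zero hne hu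
  obtain ⟨s, rfl⟩ := exists_smul_eq_of_crossMap_eq_zero hne hv
  refine h ?_
  rw [map_smul, crossMap_swap, map_smul, crossMap_self]
  simp

theorem exists_of_mem_openSegment (h : p ∈ openSegment ℝ a b) :
    ∃ t : ℝ, 0 < t ∧ t < 1 ∧ a = p - t • (b - a) ∧ b = p + (1 - t) • (b - a) := by
  rw [openSegment_eq_image'] at h
  obtain ⟨t, ⟨h0, h1⟩, rfl⟩ := h
  exact ⟨t, h0, h1, by module, by module⟩

theorem ne_of_crossing (hab : p ∈ openSegment ℝ a b) (hcd : p ∈ openSegment ℝ c d)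
    (h : crossMap (b - a) (d - c) ≠ 0) : a ≠ c := by
  rintro rfl
  obtain ⟨t, -, -, ha, -⟩ := exists_of_mem_openSegment hab
  obtain ⟨s, hs, -, hc, -⟩ := exists_of_mem_openSegment hcd
  have h1 : t • (b - a) = s • (d - a) := by
    rw [eq_sub_iff_add_eq, ← eq_sub_iff_add_eq'] at ha hc
    rw [ha, hc]
  have h2 : s * crossMap (b - a) (d - a) = 0 := by
    rw [← smul_eq_mul, ← map_smul, ← h1, map_smul, crossMap_self, smul_zero]
  rcases mul_eq_zero.1 h2 with h3 | h3
  · exact hs.ne' h3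
  · exact h h3

theorem forall_ne_of_crossing (hab : p ∈ openSegment ℝ a b) (hcd : p ∈ openSegment ℝ c d)
    (h : crossMap (b - a) (d - c) ≠ 0) : a ≠ c ∧ a ≠ d ∧ b ≠ c ∧ b ≠ d := by
  have hba := openSegment_symm ℝ a b ▸ hab
  have hdc := openSegment_symm ℝ c d ▸ hcd
  have h₂ : crossMap (b - a) (c - d) ≠ 0 := by
    rw [← neg_sub d c, map_neg]; exact neg_ne_zero.2 h
  have h₁ : crossMap (a - b) (d - c) ≠ 0 := by
    rw [← neg_sub b a, crossMap_swap, map_neg, crossMap_swap, neg_neg]; exact neg_ne_zero.2 h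
  have h₃ : crossMap (a - b) (c - d) ≠ 0 := by
    rw [← neg_sub d c, map_neg]; exact neg_ne_zero.2 h₁
  exact ⟨ne_of_crossing hab hcd h, ne_of_crossing hab hdc h₂, ne_of_crossing hba hcd h₁,
    ne_of_crossing hba hdc h₃⟩

theorem mem_convexHull_of_mem_diff {T s : Set Plane} {t q : Plane}
    (hq : q ∈ convexHull ℝ (T \ {t})) (h : ∀ y ∈ T, y ≠ t → y ∈ s) : q ∈ convexHull ℝ s :=
  convexHull_mono (fun y hy => h y hy.1 hy.2) hq

/-- If `He(S) ≤ 3`, the crossing point of two segments spanned by `S` lies in `S`. -/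
theorem HellyProperty.mem_of_crossing (hS : HellyProperty S 3) (ha : a ∈ S) (hb : b ∈ S)
    (hc : c ∈ S) (hd : d ∈ S) (hab : p ∈ openSegment ℝ a b) (hcd : p ∈ openSegment ℝ c d)
    (h : crossMap (b - a) (d - c) ≠ 0) : p ∈ S := by
  classical
  have hne : a ≠ b := by
    rintro rfl
    simp [crossMap_apply] at h
  have hne' : c ≠ d := by
    rintro rfl
    simp [crossMap_apply] at h
  obtain ⟨hac, had, hbc, hbd⟩ := forall_ne_of_crossing hab hcd h
  obtain ⟨q, hqS, hq⟩ := hS.exists_mem_forall_convexHull_diff (T := {a, b, c, d})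
    (by
      intro y hy
      simp only [Finset.coe_insert, Finset.coe_singleton, Set.mem_insert_iff,
        Set.mem_singleton_iff] at hy
      rcases hy with rfl | rfl | rfl | rfl <;> assumption)
    (by
      rw [Finset.card_insert_of_notMem, Finset.card_insert_of_notMem, Finset.card_pair hne']
      · norm_num
      · simp [hbc, hbd]
      · simp [hne, hac, had])
  -- on the line `ab` the functional `crossMap (b - a)` is constant, and `c`, `d` are on
  -- different sides
  have key : ∀ {a b c d : Plane}, p ∈ openSegment ℝ a b → p ∈ openSegment ℝ c d →
      crossMap (b - a) (d - c) ≠ 0 → q ∈ convexHull ℝ {a, b, c} → q ∈ convexHull ℝ {a, b, d} →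
      crossMap (b - a) (q - p) = 0 := by
    intro a b c d hab hcd h h1 h2
    obtain ⟨t, -, -, ha, hb⟩ := exists_of_mem_openSegment hab
    obtain ⟨s, hs0, hs1, hc, hd⟩ := exists_of_mem_openSegment hcd
    have hF := crossMap_self (b - a)
    generalize hFe : crossMap (b - a) = F at *
    have hfa : F a = F p := by
      have := congrArg F ha
      rwa [map_sub F p, map_smul, hF, smul_zero, sub_zero] at this
    have hfb : F b = F p := by
      have := congrArg F hb
      rwa [map_add F p, map_smul, hF, smul_zero, add_zero] at this
    have hfc : F c = F p - s * F (d - c) := by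
      have := congrArg F hc
      rwa [map_sub F p, map_smul, smul_eq_mul] at this
    have hfd : F d = F p + (1 - s) * F (d - c) := by
      have := congrArg F hd
      rwa [map_add F p, map_smul, smul_eq_mul] at this
    have hD := mul_self_nonneg (F (d - c))
    have hle : F (d - c) * F q ≤ F (d - c) * F p := by
      obtain ⟨y, hy, hqy⟩ := exists_le_of_mem_convexHull h1 (F (d - c) • F)
      refine hqy.trans ?_
      simp only [LinearMap.smul_apply, smul_eq_mul]
      rcases hy with rfl | rfl | rfl
      · rw [hfa]
      · rw [hfb]
      · rw [hfc]
        nlinarith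
    have hge : F (d - c) * F p ≤ F (d - c) * F q := by
      obtain ⟨y, hy, hqy⟩ := exists_le_of_mem_convexHull h2 (-(F (d - c) • F))
      simp only [LinearMap.neg_apply, LinearMap.smul_apply, smul_eq_mul, neg_le_neg_iff] at hqy
      refine le_trans ?_ hqy
      rcases hy with rfl | rfl | rfl
      · rw [hfa]
      · rw [hfb]
      · rw [hfd]
        nlinarith
    rw [map_sub, sub_eq_zero]
    exact mul_left_cancel₀ h (le_antisymm hle hge)
  have hu : crossMap (b - a) (q - p) = 0 :=
    key hab hcd h (mem_convexHull_of_mem_diff (hq d (by simp)) (by simp))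
      (mem_convexHull_of_mem_diff (hq c (by simp)) (by simp))
  have hv : crossMap (d - c) (q - p) = 0 :=
    key hcd hab (by rw [crossMap_swap]; exact neg_ne_zero.2 h)
      (mem_convexHull_of_mem_diff (hq b (by simp)) (by simp))
      (mem_convexHull_of_mem_diff (hq a (by simp)) (by simp))
  exact eq_of_crossMap_sub_eq_zero h hu hv ▸ hqS

/-- By Carathéodory's theorem, a point of a planar hull is a vertex, lies on a segment between two
vertices, or is interior to a triangle. -/
theorem mem_nhds_or_exists_openSegment {s : Set Plane} (hp : p ∈ convexHull ℝ s) (hps : p ∉ s) :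
    convexHull ℝ s ∈ 𝓝 p ∨ ∃ a ∈ s, ∃ b ∈ s, a ≠ b ∧ p ∈ openSegment ℝ a b := by
  obtain ⟨κ, _, z, w, hz, hind, hw, hw1, hsum⟩ := eq_pos_convex_span_of_mem_convexHull hp
  have hκ : Fintype.card κ ≤ 3 := by
    have h1 := hind.card_le_finrank_succ
    have h2 := Submodule.finrank_le (vectorSpan ℝ (Set.range z))
    rw [finrank_euclideanSpace_fin] at h2
    omega
  have hz' : ∀ i, z i ∈ s := fun i => hz ⟨i, rfl⟩
  obtain h | h | h | h : Fintype.card κ = 0 ∨ Fintype.card κ = 1 ∨ Fintype.card κ = 2 ∨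
      Fintype.card κ = 3 := by omega
  · rw [Fintype.card_eq_zero_iff] at h
    simp at hw1
  · exfalso
    obtain ⟨i, hi⟩ := Fintype.card_eq_one_iff.1 h
    have hu : (Finset.univ : Finset κ) = {i} := by ext j; simp [hi j]
    rw [hu, Finset.sum_singleton] at hw1 hsum
    rw [hw1, one_smul] at hsum
    exact hps (hsum ▸ hz' i)
  · right
    let e := Fintype.equivFinOfCardEq h
    rw [← e.symm.sum_comp, Fin.sum_univ_two] at hw1 hsum
    refine ⟨_, hz' (e.symm 0), _, hz' (e.symm 1), ?_, _, _, hw _, hw _, hw1, hsum⟩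
    exact hind.injective.ne (by simp)
  · left
    let B : AffineBasis κ ℝ Plane := ⟨z, hind, by
      rw [hind.affineSpan_eq_top_iff_card_eq_finrank_add_one, h, finrank_euclideanSpace_fin]⟩
    refine mem_of_superset (mem_interior_iff_mem_nhds.1 ?_) (convexHull_mono hz)
    have hB : interior (convexHull ℝ (Set.range z)) = {y | ∀ i, 0 < B.coord i y} :=
      B.interior_convexHull
    rw [hB]
    intro i
    have h1 : Finset.univ.affineCombination ℝ B w = p := by
      rw [Finset.affineCombination_eq_linear_combination _ _ _ hw1]
      exact hsum
    rw [← h1, B.coord_apply_combination_of_mem (Finset.mem_univ i) hw1]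
    exact hw i

/-- An extreme point of an intersection of polygons spanned by the points `x i` is one of these
points or a crossing of two segments between them: otherwise the point could be moved both ways in
some direction inside all the polygons. -/
theorem exists_crossing_of_mem_extremePoints {𝒥 : Finset (Finset ι)}
    (hp : p ∈ (⋂ J ∈ 𝒥, convexHull ℝ (x '' (J : Set ι))).extremePoints ℝ)
    (h𝒥 : ∀ J ∈ 𝒥, J ⊆ I) (hne : ∀ i ∈ I, x i ≠ p) :
    ∃ a ∈ I, ∃ b ∈ I, ∃ c ∈ I, ∃ d ∈ I, p ∈ openSegment ℝ (x a) (x b) ∧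
      p ∈ openSegment ℝ (x c) (x d) ∧ crossMap (x b - x a) (x d - x c) ≠ 0 := by
  by_contra! hcon
  obtain ⟨hpK, hext⟩ := hp
  rw [Set.mem_iInter₂] at hpK
  have hloc : ∀ J ∈ 𝒥, convexHull ℝ (x '' (J : Set ι)) ∈ 𝓝 p ∨
      ∃ a ∈ J, ∃ b ∈ J, x a ≠ x b ∧ p ∈ openSegment ℝ (x a) (x b) := by
    intro J hJ
    rcases mem_nhds_or_exists_openSegment (hpK J hJ) (by
      rintro ⟨i, hi, hip⟩
      exact hne i (h𝒥 J hJ hi) hip) with h | ⟨_, ⟨a, ha, rfl⟩, _, ⟨b, hb, rfl⟩, h⟩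
    · exact Or.inl h
    · exact Or.inr ⟨a, ha, b, hb, h⟩
  have hcont : ∀ v : Plane, Tendsto (fun δ : ℝ => p + δ • v) (𝓝 0) (𝓝 p) := by
    intro v
    have : Continuous fun δ : ℝ => p + δ • v := by fun_prop
    simpa using this.tendsto 0
  obtain ⟨v, hv, hev⟩ : ∃ v : Plane, v ≠ 0 ∧
      ∀ J ∈ 𝒥, ∀ᶠ δ in 𝓝 (0 : ℝ), p + δ • v ∈ convexHull ℝ (x '' (J : Set ι)) := by
    by_cases hex : ∃ J ∈ 𝒥, ∃ a ∈ J, ∃ b ∈ J, x a ≠ x b ∧ p ∈ openSegment ℝ (x a) (x b)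
    · obtain ⟨J, hJ, a, ha, b, hb, hab, hpab⟩ := hex
      refine ⟨x b - x a, sub_ne_zero.2 hab.symm, fun J' hJ' => ?_⟩
      rcases hloc J' hJ' with h | ⟨c, hc, d, hd, hcd, hpcd⟩
      · exact (hcont _).eventually h
      · have h0 := hcon a (h𝒥 J hJ ha) b (h𝒥 J hJ hb) c (h𝒥 J' hJ' hc) d (h𝒥 J' hJ' hd) hpab hpcd
        obtain ⟨r, hr⟩ := exists_smul_eq_of_crossMap_eq_zero (sub_ne_zero.2 hcd.symm)
          (v := x b - x a) (by rw [crossMap_swap, h0, neg_zero])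
        rw [openSegment_eq_image'] at hpcd
        obtain ⟨t, ht, rfl⟩ := hpcd
        have hcont' : Tendsto (fun δ : ℝ => t + δ * r) (𝓝 0) (𝓝 t) := by
          have : Continuous fun δ : ℝ => t + δ * r := by fun_prop
          simpa using this.tendsto 0
        filter_upwards [hcont'.eventually (isOpen_Ioo.mem_nhds ht)] with δ hδ
        refine segment_subset_convexHull (Set.mem_image_of_mem x hc) (Set.mem_image_of_mem x hd)
          (openSegment_subset_segment _ _ _ ?_)
        rw [openSegment_eq_image']
        refine ⟨_, hδ, ?_⟩
        simp only [hr, add_smul, mul_smul]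
        abel
    · refine ⟨!₂[1, 0], ?_, fun J hJ => ?_⟩
      · intro h0
        simpa using congrArg (fun u : Plane => u 0) h0
      · rcases hloc J hJ with h | h
        · exact (hcont _).eventually h
        · exact absurd ⟨J, hJ, h⟩ hex
  have hev' := (eventually_all_finset 𝒥).2 hev
  have hneg : ∀ᶠ δ in 𝓝 (0 : ℝ), ∀ J ∈ 𝒥, p + (-δ) • v ∈ convexHull ℝ (x '' (J : Set ι)) := by
    have : Tendsto (fun δ : ℝ => -δ) (𝓝 0) (𝓝 0) := by simpa using (continuous_neg (G := ℝ)).tendsto 0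
    exact this.eventually hev'
  obtain ⟨δ, ⟨h1, h2⟩, hδ⟩ :=
    ((((hev'.and hneg).filter_mono nhdsWithin_le_nhds).and
      (self_mem_nhdsWithin : {0}ᶜ ∈ 𝓝[≠] (0 : ℝ)))).exists
  have h3 := hext (Set.mem_iInter₂.2 h1) (Set.mem_iInter₂.2 h2)
    ⟨1 / 2, 1 / 2, by norm_num, by norm_num, by norm_num, by module⟩
  simp only [add_eq_left, smul_eq_zero, hv, or_false] at h3
  exact hδ h3

theorem eventually_add_mul_ne_zero (a : ℝ) {g : ℝ} (hg : g ≠ 0) :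
    ∀ᶠ ε in 𝓝[>] (0 : ℝ), a + ε * g ≠ 0 := by
  have h : ∀ ε, a + ε * g = 0 → ε = -a / g := by
    intro ε hε
    field_simp
    linarith
  by_cases ha : -a / g = 0
  · filter_upwards [self_mem_nhdsWithin] with ε hε h0
    exact (Set.mem_Ioi.1 hε).ne' ((h ε h0).trans ha)
  · filter_upwards [(eventually_ne_nhds (Ne.symm ha)).filter_mono nhdsWithin_le_nhds] with ε hε h0
    exact hε (h ε h0)

/-- Removing the ends of two segments that cross at `p` lowers the depth of `p` by at most `2`:
a generic closed half-plane at `p` contains just one end of each, and a half-plane whose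
boundary contains one of the segments is compared with a slightly tilted one. -/
theorem DepthAtLeast.sdiff_crossing [DecidableEq ι] (h : DepthAtLeast x I p m) {a b c d : ι}
    (hab : p ∈ openSegment ℝ (x a) (x b)) (hcd : p ∈ openSegment ℝ (x c) (x d))
    (hcross : crossMap (x b - x a) (x d - x c) ≠ 0) :
    DepthAtLeast x (I \ {a, b, c, d}) p (m - 2) := by
  classical
  intro f
  let u := x b - x a
  let v := x d - x c
  let g := crossMap (u + v)
  have hgu : g u ≠ 0 := by
    simp only [g]
    rw [crossMap_swap, map_add, crossMap_self, zero_add]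
    exact neg_ne_zero.2 hcross
  have hgv : g v ≠ 0 := by
    simp only [g]
    rw [crossMap_swap, map_add, crossMap_self, add_zero, crossMap_swap, neg_neg]
    exact hcross
  have hlt : ∀ i ∈ I, ∀ᶠ ε in 𝓝[>] (0 : ℝ), f (x i) < f p → f (x i) + ε * g (x i) < f p + ε * g p := by
    intro i _
    by_cases hi : f (x i) < f p
    · have h1 : Tendsto (fun ε : ℝ => f (x i) + ε * g (x i)) (𝓝 0) (𝓝 (f (x i))) := by
        have : Continuous fun ε : ℝ => f (x i) + ε * g (x i) := by fun_prop
        simpa using this.tendsto 0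
      have h2 : Tendsto (fun ε : ℝ => f p + ε * g p) (𝓝 0) (𝓝 (f p)) := by
        have : Continuous fun ε : ℝ => f p + ε * g p := by fun_prop
        simpa using this.tendsto 0
      filter_upwards [(h1.eventually_lt h2 hi).filter_mono nhdsWithin_le_nhds] with ε hε _
      exact hε
    · exact Eventually.of_forall fun _ hi' => absurd hi' hi
  obtain ⟨ε, ⟨hu, hv⟩, hε⟩ := (((eventually_add_mul_ne_zero (f u) hgu).and
    (eventually_add_mul_ne_zero (f v) hgv)).and ((eventually_all_finset I).2 hlt)).exists
  let f' : Plane →ₗ[ℝ] ℝ := f + ε • g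
  have hone : ∀ {s t : ι}, p ∈ openSegment ℝ (x s) (x t) → f' (x t - x s) ≠ 0 →
      ∃ r, ∀ i, i = s ∨ i = t → f' p ≤ f' (x i) → i = r := by
    intro s t hst hne
    obtain ⟨l, hl0, hl1, hs, ht⟩ := exists_of_mem_openSegment hst
    have e1 : f' (x s) = f' p - l * f' (x t - x s) := by
      conv_lhs => rw [hs]
      rw [map_sub f' p, map_smul, smul_eq_mul]
    have e2 : f' (x t) = f' p + (1 - l) * f' (x t - x s) := by
      conv_lhs => rw [ht]
      rw [map_add f' p, map_smul, smul_eq_mul]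
    rcases lt_or_gt_of_ne hne with hneg | hpos
    · refine ⟨s, ?_⟩
      rintro i (rfl | rfl) hi
      · rfl
      · nlinarith
    · refine ⟨t, ?_⟩
      rintro i (rfl | rfl) hi
      · nlinarith
      · rfl
  obtain ⟨r₁, hr₁⟩ := hone hab hu
  obtain ⟨r₂, hr₂⟩ := hone hcd hv
  have hsub : (I.filter fun i => f' p ≤ f' (x i)) ⊆
      ((I \ {a, b, c, d}).filter fun i => f p ≤ f (x i)) ∪ {r₁, r₂} := by
    intro i hi
    obtain ⟨hiI, hi⟩ := Finset.mem_filter.1 hi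
    have h1 : f p ≤ f (x i) := by
      by_contra! hcon
      exact absurd hi (not_le.2 (hε i hiI hcon))
    have h2 := fun h' => hr₁ i h' hi
    have h3 := fun h' => hr₂ i h' hi
    simp only [Finset.mem_union, Finset.mem_filter, Finset.mem_sdiff, Finset.mem_insert,
      Finset.mem_singleton, hiI, h1, true_and, and_true]
    tauto
  have h1 : m ≤ (I.filter fun i => f' p ≤ f' (x i)).card := by convert h f'
  have h2 := (Finset.card_le_card hsub).trans (Finset.card_union_le _ _)
  have h3 : ({r₁, r₂} : Finset ι).card ≤ 2 := Finset.card_le_two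
  have h4 : m - 2 ≤ ((I \ {a, b, c, d}).filter fun i => f p ≤ f (x i)).card := by omega
  convert h4

end Crossing

/-! ### Upper bounds for the Tverberg numbers -/

section UpperBounds

variable {S : Set Plane} {ι : Type*} {x : ι → Plane} {I : Finset ι} {m k : ℕ}

theorem HellyProperty.exists_splitsAround_of_three (h : HellyProperty S 3) (hx : ∀ i ∈ I, x i ∈ S)
    (hm : 2 ≤ m) (hI : 3 * (m - 1) < I.card) : ∃ p ∈ S, SplitsAround x I m p := by
  classical
  let 𝒥 := I.powerset.filter fun J => I.card < J.card + m
  let K := ⋂ J ∈ 𝒥, convexHull ℝ (x '' (J : Set ι))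
  have hI𝒥 : I ∈ 𝒥 := Finset.mem_filter.2 ⟨Finset.mem_powerset_self I, by omega⟩
  have hKc : IsCompact K := by
    refine ((I.finite_toSet.image x).isCompact_convexHull ℝ).of_isClosed_subset ?_
      (Set.biInter_subset_of_mem (Finset.mem_coe.2 hI𝒥))
    exact isClosed_biInter fun J _ => (J.finite_toSet.image x).isClosed_convexHull ℝ
  have hKne : K.Nonempty := by
    obtain ⟨q, -, hq⟩ := h.exists_center hx hI
    refine ⟨q, Set.mem_iInter₂.2 fun J hJ => ?_⟩
    obtain ⟨h1, h2⟩ := Finset.mem_filter.1 hJ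
    exact hq J (Finset.mem_powerset.1 h1) h2
  obtain ⟨p, hp⟩ := hKc.extremePoints_nonempty hKne
  have hd : DepthAtLeast x I p m := depthAtLeast_of_forall_mem_convexHull fun J hJ hJm =>
    Set.mem_iInter₂.1 hp.1 J (Finset.mem_filter.2 ⟨Finset.mem_powerset.2 hJ, hJm⟩)
  by_cases hex : ∃ i ∈ I, x i = p
  · obtain ⟨i, hi, rfl⟩ := hex
    refine ⟨x i, hx i hi, ?_⟩
    have hc : (I \ {i}).card = I.card - 1 := by
      rw [Finset.card_sdiff_of_subset (by simpa using hi), Finset.card_singleton]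
    have h1 := (hd.sdiff {i}).splitsAround (by rw [hc, Finset.card_singleton]; omega)
    have h2 : SplitsAround x {i} 1 (x i) := splitsAround_one (by simp)
    refine ((h1.union h2 Finset.sdiff_disjoint).of_le ?_).mono ?_
    · rw [Finset.card_singleton]
      omega
    · exact Finset.union_subset Finset.sdiff_subset (by simpa using hi)
  · push Not at hex
    obtain ⟨a, ha, b, hb, c, hc, d, hd', hab, hcd, hcross⟩ :=
      exists_crossing_of_mem_extremePoints hp
        (fun J hJ => Finset.mem_powerset.1 (Finset.mem_filter.1 hJ).1) hex
    refine ⟨p, h.mem_of_crossing (hx a ha) (hx b hb) (hx c hc) (hx d hd') hab hcd hcross, ?_⟩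
    have hcard : I.card - 4 ≤ (I \ {a, b, c, d}).card :=
      (Nat.sub_le_sub_left Finset.card_le_four _).trans (Finset.le_card_sdiff _ _)
    have h1 := (hd.sdiff_crossing hab hcd hcross).splitsAround (by omega)
    have h2 : SplitsAround x ({a, b} ∪ {c, d}) (1 + 1) p := by
      refine (splitsAround_one ?_).union (splitsAround_one ?_) ?_
      · simpa [Set.image_pair, convexHull_pair] using openSegment_subset_segment _ _ _ hab
      · simpa [Set.image_pair, convexHull_pair] using openSegment_subset_segment _ _ _ hcd
      · obtain ⟨hac, had, hbc, hbd⟩ := forall_ne_of_crossing hab hcd hcross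
        have h' : ∀ {i j : ι}, x i ≠ x j → j ≠ i := fun hij e => hij (e ▸ rfl)
        simp [h' hac, h' had, h' hbc, h' hbd]
    refine ((h1.union h2 ?_).of_le (by omega)).mono ?_
    · refine Finset.disjoint_of_subset_right ?_ Finset.sdiff_disjoint
      intro i
      simp only [Finset.mem_union, Finset.mem_insert, Finset.mem_singleton]
      tauto
    · refine Finset.union_subset Finset.sdiff_subset ?_
      intro i
      simp only [Finset.mem_union, Finset.mem_insert, Finset.mem_singleton]
      rintro ((rfl | rfl) | (rfl | rfl)) <;> assumption

/-- If `He(S) ≤ 2`, then `S` is contained in a line, and the points on the two sides of a median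
`p` are matched. -/
theorem HellyProperty.exists_splitsAround_of_two (h : HellyProperty S 2) (hx : ∀ i ∈ I, x i ∈ S)
    (hI : 2 * (m - 1) < I.card) : ∃ p ∈ S, SplitsAround x I m p := by
  classical
  obtain ⟨p, hpS, hp⟩ := h.exists_center hx hI
  refine ⟨p, hpS, ?_⟩
  have hd : DepthAtLeast x I p m := depthAtLeast_of_forall_mem_convexHull hp
  let I₀ := I.filter fun i => x i = p
  have h₀ : SplitsAround x I₀ I₀.card p :=
    splitsAround_card fun i hi => (Finset.mem_filter.1 hi).2
  rcases le_or_gt m I₀.card with hle | hlt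
  · exact (h₀.of_le hle).mono (Finset.filter_subset _ _)
  -- three points of `S` are collinear, one of them being between the others
  have hbetw : ∀ a ∈ S, ∀ b ∈ S, a ≠ b → a ≠ p → b ≠ p →
      ∃ q, q ∈ segment ℝ a b ∧ q ∈ segment ℝ a p ∧ q ∈ segment ℝ b p := by
    intro a ha b hb hab hap hbp
    obtain ⟨q, -, hq⟩ := h.exists_mem_forall_convexHull_diff (T := {a, b, p})
      (by
        intro y hy
        simp only [Finset.coe_insert, Finset.coe_singleton, Set.mem_insert_iff,
          Set.mem_singleton_iff] at hy
        rcases hy with rfl | rfl | rfl <;> assumption)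
      (by
        rw [Finset.card_insert_of_notMem (by simp [hab, hap]), Finset.card_pair hbp]
        norm_num)
    refine ⟨q, ?_, ?_, ?_⟩
    · rw [← convexHull_pair]
      exact mem_convexHull_of_mem_diff (hq p (by simp)) (by simp)
    · rw [← convexHull_pair]
      exact mem_convexHull_of_mem_diff (hq b (by simp)) (by simp)
    · rw [← convexHull_pair]
      exact mem_convexHull_of_mem_diff (hq a (by simp)) (by simp)
  obtain ⟨i₁, hi₁, hi₁p⟩ : ∃ i ∈ I, x i ≠ p := by
    by_contra! hcon
    have : I₀ = I := Finset.filter_true_of_mem hcon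
    rw [this] at hlt
    omega
  obtain ⟨f, hf⟩ : ∃ f : Plane →ₗ[ℝ] ℝ, f (x i₁) ≠ f p := by
    by_contra! hcon
    refine hi₁p ?_
    ext j
    exact hcon (EuclideanSpace.proj (𝕜 := ℝ) j).toLinearMap
  -- a point of a segment on which `f` is not constant is determined by the value of `f`
  have heq : ∀ a q, q ∈ segment ℝ a p → f a ≠ f p → f q = f p → q = p := by
    intro a q hq hap hqp
    rw [segment_symm, segment_eq_image'] at hq
    obtain ⟨t, -, rfl⟩ := hq
    simp only [map_add, map_smul, map_sub, smul_eq_mul, add_eq_left, mul_eq_zero, sub_eq_zero,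
      hap, or_false] at hqp
    simp [hqp]
  have hbd : ∀ {a b q : Plane} (g : Plane →ₗ[ℝ] ℝ), q ∈ segment ℝ a b →
      g a ≤ g b → g a ≤ g q ∧ g q ≤ g b := by
    intro a b q g hq hab
    rw [segment_eq_image'] at hq
    obtain ⟨t, ⟨ht0, ht1⟩, rfl⟩ := hq
    simp only [map_add, map_smul, map_sub, smul_eq_mul]
    constructor <;> nlinarith
  have hfne : ∀ i ∈ I, x i ≠ p → f (x i) ≠ f p := by
    intro i hi hip hfi
    obtain ⟨q, h1, h2, h3⟩ := hbetw (x i₁) (hx _ hi₁) (x i) (hx i hi)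
      (fun e => hf (e ▸ hfi)) hi₁p hip
    have hq := hbd f h3 hfi.le
    have hqp : q = p := heq _ q h2 hf (le_antisymm hq.2 (hfi ▸ hq.1))
    rw [segment_symm, segment_eq_image'] at h1
    obtain ⟨t, -, ht⟩ := h1
    have h5 := congrArg f ht
    simp only [map_add, map_smul, map_sub, smul_eq_mul, hqp, hfi] at h5
    have h6 : t = 0 := by
      have : t * (f (x i₁) - f p) = 0 := by linarith
      simpa [sub_eq_zero, hf] using this
    simp only [h6, zero_smul, add_zero, hqp] at ht
    exact hip ht
  let P := I.filter fun i => f p < f (x i)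
  let N := I.filter fun i => f (x i) < f p
  have hP : m - I₀.card ≤ P.card := by
    have h1 : m ≤ (I.filter fun i => f p ≤ f (x i)).card := by convert hd f
    have h2 : (I.filter fun i => f p ≤ f (x i)) ⊆ I₀ ∪ P := by
      intro i hi
      obtain ⟨hiI, hi⟩ := Finset.mem_filter.1 hi
      by_cases hip : x i = p
      · exact Finset.mem_union_left _ (Finset.mem_filter.2 ⟨hiI, hip⟩)
      · exact Finset.mem_union_right _
          (Finset.mem_filter.2 ⟨hiI, lt_of_le_of_ne hi (hfne i hiI hip).symm⟩)
    have h3 := (Finset.card_le_card h2).trans (Finset.card_union_le _ _)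
    omega
  have hN : m - I₀.card ≤ N.card := by
    have h1 : m ≤ (I.filter fun i => (-f) p ≤ (-f) (x i)).card := by convert hd (-f)
    have h2 : (I.filter fun i => (-f) p ≤ (-f) (x i)) ⊆ I₀ ∪ N := by
      intro i hi
      obtain ⟨hiI, hi⟩ := Finset.mem_filter.1 hi
      rw [LinearMap.neg_apply, LinearMap.neg_apply, neg_le_neg_iff] at hi
      by_cases hip : x i = p
      · exact Finset.mem_union_left _ (Finset.mem_filter.2 ⟨hiI, hip⟩)
      · exact Finset.mem_union_right _
          (Finset.mem_filter.2 ⟨hiI, lt_of_le_of_ne hi (hfne i hiI hip)⟩)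
    have h3 := (Finset.card_le_card h2).trans (Finset.card_union_le _ _)
    omega
  have h₁ : SplitsAround x (P ∪ N) (m - I₀.card) p := by
    refine splitsAround_of_pairs hP hN ?_ ?_
    · rw [Finset.disjoint_left]
      intro i h1 h2
      exact lt_asymm (Finset.mem_filter.1 h1).2 (Finset.mem_filter.1 h2).2
    · intro i hi j hj
      obtain ⟨hiI, hi⟩ := Finset.mem_filter.1 hi
      obtain ⟨hjI, hj⟩ := Finset.mem_filter.1 hj
      obtain ⟨q, h1, h2, h3⟩ := hbetw (x i) (hx i hiI) (x j) (hx j hjI)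
        (fun e => by rw [e] at hi; exact lt_asymm hi hj) (fun e => hi.ne' (e ▸ rfl))
        (fun e => hj.ne (e ▸ rfl))
      have hq1 := (hbd f h3 hj.le).2
      have hq2 := (hbd f (segment_symm ℝ (x i) p ▸ h2) hi.le).1
      have hqp : q = p := heq _ q h2 hi.ne' (le_antisymm hq1 hq2)
      exact hqp ▸ h1
  refine ((h₀.union h₁ ?_).of_le (by omega)).mono ?_
  · rw [Finset.disjoint_left]
    intro i h1 h2
    have e := (Finset.mem_filter.1 h1).2
    rcases Finset.mem_union.1 h2 with h2 | h2
    · exact (Finset.mem_filter.1 h2).2.ne' (by rw [e])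
    · exact (Finset.mem_filter.1 h2).2.ne (by rw [e])
  · exact Finset.union_subset (Finset.filter_subset _ _)
      (Finset.union_subset (Finset.filter_subset _ _) (Finset.filter_subset _ _))

theorem HellyProperty.exists_splitsAround_of_one (h : HellyProperty S 1) (hx : ∀ i ∈ I, x i ∈ S)
    (hm : 1 ≤ m) (hI : m ≤ I.card) : ∃ p ∈ S, SplitsAround x I m p := by
  classical
  obtain ⟨i, hi⟩ : I.Nonempty := Finset.card_pos.1 (by omega)
  refine ⟨x i, hx i hi, (splitsAround_card fun j hj => ?_).of_le hI⟩
  by_contra hne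
  obtain ⟨q, -, hq⟩ := h.exists_mem_forall_convexHull_diff (T := {x j, x i})
    (by
      intro y hy
      simp only [Finset.coe_insert, Finset.coe_singleton, Set.mem_insert_iff,
        Set.mem_singleton_iff] at hy
      rcases hy with rfl | rfl
      · exact hx j hj
      · exact hx i hi)
    (by rw [Finset.card_pair hne]; norm_num)
  have h1 : q ∈ convexHull ℝ {x i} :=
    mem_convexHull_of_mem_diff (hq (x j) (by simp)) (by simp)
  have h2 : q ∈ convexHull ℝ {x j} :=
    mem_convexHull_of_mem_diff (hq (x i) (by simp)) (by simp)
  rw [convexHull_singleton, Set.mem_singleton_iff] at h1 h2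
  exact hne (h2 ▸ h1)

theorem HellyProperty.exists_splitsAround_of_card (h : HellyProperty S k) (hx : ∀ i ∈ I, x i ∈ S)
    (hI : k * (m - 1) < I.card) (hI' : 3 * m ≤ I.card) : ∃ p ∈ S, SplitsAround x I m p := by
  obtain ⟨p, hpS, hp⟩ := h.exists_center hx hI
  exact ⟨p, hpS, (depthAtLeast_of_forall_mem_convexHull hp).splitsAround hI'⟩

theorem HellyProperty.tverbergNumber_le (h : HellyProperty S k) (hk : 0 < k) (hm : 2 ≤ m)
    (hkm : k ≤ 3 ∨ 3 ≤ m) : tverbergNumber S m ≤ (k * (m - 1) + 1 : ℕ) := by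
  refine _root_.tverbergNumber_le (by omega) (by omega) fun x hx => ?_
  have hx' : ∀ i ∈ (Finset.univ : Finset (Fin (k * (m - 1) + 1))), x i ∈ S := fun i _ => hx i
  have hc := Finset.card_fin (k * (m - 1) + 1)
  rcases le_or_gt k 3 with hk3 | hk3
  · obtain rfl | rfl | rfl : k = 1 ∨ k = 2 ∨ k = 3 := by omega
    · exact h.exists_splitsAround_of_one hx' (by omega) (by omega)
    · exact h.exists_splitsAround_of_two hx' (by omega)
    · exact h.exists_splitsAround_of_three hx' hm (by omega)
  · refine h.exists_splitsAround_of_card hx' (by omega) ?_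
    have := Nat.mul_le_mul_right (m - 1) (show 4 ≤ k from hk3)
    omega

theorem HellyProperty.tverbergNumber_two_le (h : HellyProperty S k) (hk : 4 ≤ k) :
    tverbergNumber S 2 ≤ (k + 2 : ℕ) := by
  refine _root_.tverbergNumber_le (by omega) (by omega) fun x hx => ?_
  have hc := Finset.card_fin (k + 2)
  exact h.exists_splitsAround_of_card (fun i _ => hx i) (by omega) (by omega)

end UpperBounds

/-! ### The Helly number of the integer lattice -/

section Lattice

variable {E : Type*} [AddCommGroup E] [Module ℝ E] {S : Set E} {k : ℕ}

/-- A vertex `a` outside `conv R` is not recovered after moving it to another point `q` of the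
hull. -/
theorem notMem_convexHull_insert_of_mem {R : Set E} {a q : E} (hR : R.Nonempty)
    (hq : q ∈ convexHull ℝ (insert a R)) (hqa : q ≠ a) (ha : a ∉ convexHull ℝ R) :
    a ∉ convexHull ℝ (insert q R) := by
  intro hcon
  rw [convexHull_insert hR, mem_convexJoin] at hq hcon
  obtain ⟨a', ha', r, hr, hqr⟩ := hq
  obtain ⟨q', hq', s, hs, has⟩ := hcon
  rw [Set.mem_singleton_iff.1 ha'] at hqr
  rw [Set.mem_singleton_iff.1 hq'] at has
  rw [segment_eq_image'] at hqr has
  obtain ⟨l, ⟨hl0, hl1⟩, hl⟩ := hqr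
  obtain ⟨u, ⟨hu0, hu1⟩, hu⟩ := has
  have hl0' : 0 < l := by
    refine lt_of_le_of_ne hl0 ?_
    rintro rfl
    simp only [zero_smul, add_zero] at hl
    exact hqa hl.symm
  have hσ : 0 < (1 - u) * l + u := by nlinarith
  refine ha ?_
  have h1 : ((1 - u) * l + u) • a = ((1 - u) * l) • r + u • s := by
    have h2 : q = a + l • (r - a) := hl.symm
    have h3 : q + u • (s - q) = a := hu
    have h4 : ((1 - u) * l + u) • a = a - (1 - u) • a + ((1 - u) * l) • a := by module
    have h5 : a - (1 - u) • a = (q + u • (s - q)) - (1 - u) • a := by rw [h3]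
    rw [h4, h5, h2]
    module
  have h2 : a = ((1 - u) * l / ((1 - u) * l + u)) • r + (u / ((1 - u) * l + u)) • s := by
    rw [div_eq_inv_mul, div_eq_inv_mul, mul_smul _ ((1 - u) * l), mul_smul _ u, ← smul_add, ← h1,
      inv_smul_smul₀ hσ.ne']
  rw [h2]
  refine (convex_convexHull ℝ R) hr hs ?_ ?_ ?_
  · exact div_nonneg (mul_nonneg (by linarith) hl0) hσ.le
  · exact div_nonneg hu0 hσ.le
  · rw [← add_div, div_self hσ.ne']

/-- If any `k + 1` points of `S` include two with a further point of `S` between them, then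
`He(S) ≤ k`. A counterexample to Hoffman's criterion with fewest points of `S` in its hull leads to
a contradiction: replacing a vertex by a point of `S` in the hull shrinks the hull, and the common
point obtained for the new vertex set misses at most one of the old hulls `conv (T \ {t})`. -/
theorem hellyProperty_of_exists_mem_openSegment
    (hfin : ∀ T : Finset E, (T : Set E) ⊆ S → (convexHull ℝ (T : Set E) ∩ S).Finite)
    (h : ∀ T : Finset E, (T : Set E) ⊆ S → T.card = k + 1 →
      ∃ a ∈ T, ∃ b ∈ T, a ≠ b ∧ ∃ c ∈ S, c ∈ openSegment ℝ a b) : HellyProperty S k := by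
  classical
  refine hellyProperty_of_forall_exists_mem_convexHull_diff fun T => ?_
  induction hn : (convexHull ℝ (T : Set E) ∩ S).ncard using Nat.strong_induction_on
    generalizing T with
  | _ n ih =>
  intro hTS hcard
  by_contra! hcon
  -- replacing the vertex `a` by the point `q`
  have hrep : ∀ a ∈ T, ∀ q ∈ S, q ∈ convexHull ℝ (T : Set E) → q ∉ T →
      a ∉ convexHull ℝ (insert q ((T : Set E) \ {a})) →
      ∃ r ∈ S, r ∈ convexHull ℝ ((T : Set E) \ {a}) ∧
        ∀ t ∈ T, t ≠ a → r ∈ convexHull ℝ (insert q (((T : Set E) \ {a}) \ {t})) := by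
    intro a ha q hqS hqT hqT' haq
    have hcoe : ((insert q (T.erase a) : Finset E) : Set E) = insert q ((T : Set E) \ {a}) := by
      simp
    have hq' : q ∉ T.erase a := fun hq' => hqT' (Finset.mem_of_mem_erase hq')
    have hsub : convexHull ℝ (insert q ((T : Set E) \ {a})) ⊆ convexHull ℝ (T : Set E) := by
      refine convexHull_min ?_ (convex_convexHull ℝ _)
      rintro y (rfl | hy)
      · exact hqT
      · exact subset_convexHull ℝ _ hy.1
    have hlt : (convexHull ℝ ((insert q (T.erase a) : Finset E) : Set E) ∩ S).ncard < n := by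
      rw [← hn, hcoe]
      refine Set.ncard_lt_ncard ?_ (hfin T hTS)
      refine ⟨Set.inter_subset_inter_left _ hsub, fun hle => haq ?_⟩
      exact (hle ⟨subset_convexHull ℝ _ ha, hTS ha⟩).1
    obtain ⟨r, hrS, hr⟩ := ih _ hlt _ rfl
      (by
        rw [hcoe]
        rintro y (rfl | hy)
        · exact hqS
        · exact hTS hy.1)
      (by
        rw [Finset.card_insert_of_notMem hq', Finset.card_erase_of_mem ha, hcard]
        rfl)
    rw [hcoe] at hr
    refine ⟨r, hrS, ?_, fun t ht hta => ?_⟩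
    · refine convexHull_mono ?_ (hr q (Finset.mem_insert_self _ _))
      rintro y ⟨rfl | hy, hyq⟩
      · exact absurd rfl hyq
      · exact hy
    · refine convexHull_mono ?_ (hr t (Finset.mem_insert_of_mem (Finset.mem_erase.2 ⟨hta, ht⟩)))
      rintro y ⟨rfl | hy, hyt⟩
      · exact Or.inl rfl
      · exact Or.inr ⟨hy, hyt⟩
  have hself : ∀ t ∈ T, t ∉ convexHull ℝ ((T : Set E) \ {t}) := by
    intro t ht htT
    obtain ⟨s, hs, hts⟩ := hcon t (hTS ht)
    by_cases hst : t = s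
    · exact hts (hst ▸ htT)
    · exact hts (subset_convexHull ℝ _ ⟨ht, hst⟩)
  obtain ⟨a, ha, b, hb, hab, c, hcS, hc⟩ := h T hTS hcard
  have hins : ∀ {t}, t ∈ T → insert t ((T : Set E) \ {t}) = T := fun ht => by
    rw [Set.insert_sdiff_singleton, Set.insert_eq_of_mem (Finset.mem_coe.2 ht)]
  have hmem : ∀ {s t}, s ∈ T → s ≠ t → s ∈ (T : Set E) \ {t} := fun hs hst => ⟨hs, hst⟩
  -- no point of `S` other than `a` misses the hull without `a` only
  have hmiss : ∀ q ∈ S, q ∈ convexHull ℝ (T : Set E) → q ≠ a →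
      ¬ ∀ t ∈ T, t ≠ a → q ∈ convexHull ℝ ((T : Set E) \ {t}) := by
    intro q hqS hqT hqa hq
    have hqT' : q ∉ T := by
      intro hq'
      obtain ⟨t, ht, hqt⟩ := hcon q hqS
      by_cases hta : t = a
      · exact hqt (subset_convexHull ℝ _ ⟨hq', by simpa [hta] using hqa⟩)
      · exact hqt (hq t ht hta)
    have haq := notMem_convexHull_insert_of_mem ⟨b, hmem hb hab.symm⟩ (by rwa [hins ha]) hqa
      (hself a ha)
    obtain ⟨r, hrS, hra, hr⟩ := hrep a ha q hqS hqT hqT' haq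
    obtain ⟨t, ht, hrt⟩ := hcon r hrS
    by_cases hta : t = a
    · exact hrt (hta ▸ hra)
    · refine hrt (convexHull_min ?_ (convex_convexHull ℝ _) (hr t ht hta))
      rintro y (rfl | ⟨⟨hy, -⟩, hyt⟩)
      · exact hq t ht hta
      · exact subset_convexHull ℝ _ ⟨hy, hyt⟩
  have hct : ∀ t ∈ T, t ≠ a → t ≠ b → c ∈ convexHull ℝ ((T : Set E) \ {t}) :=
    fun t _ hta htb => segment_subset_convexHull (hmem ha hta.symm) (hmem hb htb.symm)
      (openSegment_subset_segment _ _ _ hc)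
  have hcT : c ∈ convexHull ℝ (T : Set E) :=
    segment_subset_convexHull ha hb (openSegment_subset_segment _ _ _ hc)
  have hca : c ≠ a := by
    rintro rfl
    exact hab (left_mem_openSegment_iff.1 hc)
  have hcb : c ≠ b := by
    rintro rfl
    exact hab (right_mem_openSegment_iff.1 hc)
  have hcT' : c ∉ T := by
    intro hc'
    obtain ⟨t, ht, hct'⟩ := hcon c hcS
    by_cases hta : t = a
    · exact hct' (subset_convexHull ℝ _ (hta ▸ hmem hc' hca))
    by_cases htb : t = b
    · exact hct' (subset_convexHull ℝ _ (htb ▸ hmem hc' hcb))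
    · exact hct' (hct t ht hta htb)
  by_cases hcKb : c ∈ convexHull ℝ ((T : Set E) \ {b})
  · refine hmiss c hcS hcT hca fun t ht hta => ?_
    by_cases htb : t = b
    · exact htb ▸ hcKb
    · exact hct t ht hta htb
  · obtain ⟨r, hrS, hrb, hr⟩ := hrep b hb c hcS hcT hcT'
      (notMem_convexHull_insert_of_mem ⟨a, hmem ha hab⟩ (by rwa [hins hb]) hcb (hself b hb))
    refine hmiss r hrS (convexHull_mono Set.sdiff_subset hrb) ?_ fun t ht hta => ?_
    · rintro rfl
      refine notMem_convexHull_insert_of_mem ⟨b, hmem hb hab.symm⟩ (by rwa [hins ha]) hca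
        (hself _ ha) (convexHull_mono ?_ (hr _ ha hab))
      rintro y (rfl | ⟨⟨hy, -⟩, hya⟩)
      · exact Or.inl rfl
      · exact Or.inr ⟨hy, hya⟩
    · by_cases htb : t = b
      · exact htb ▸ hrb
      · refine convexHull_min ?_ (convex_convexHull ℝ _) (hr t ht htb)
        rintro y (rfl | ⟨⟨hy, -⟩, hyt⟩)
        · exact hct t ht hta htb
        · exact subset_convexHull ℝ _ ⟨hy, hyt⟩

theorem mem_integerLattice (y z : ℤ) : (!₂[(y : ℝ), (z : ℝ)] : Plane) ∈ integerLattice := by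
  intro i
  fin_cases i
  · exact ⟨y, by simp⟩
  · exact ⟨z, by simp⟩

theorem finite_inter_integerLattice {K : Set Plane} (hK : Bornology.IsBounded K) :
    (K ∩ integerLattice).Finite := by
  obtain ⟨R, hR⟩ := hK.subset_closedBall 0
  let N : ℤ := ⌈R⌉
  refine (((Set.finite_Icc (-N) N).prod (Set.finite_Icc (-N) N)).image
    fun z : ℤ × ℤ => (!₂[(z.1 : ℝ), (z.2 : ℝ)] : Plane)).subset ?_
  rintro y ⟨hyK, hy⟩
  have hbd : ∀ i (z : ℤ), y i = z → z ∈ Set.Icc (-N) N := by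
    intro i z hz
    have h1 : ‖y i‖ ≤ R := (PiLp.norm_apply_le y i).trans (by simpa using hR hyK)
    have h2 : |(z : ℝ)| ≤ N := by
      rw [← hz]
      exact h1.trans (Int.le_ceil R)
    rw [Set.mem_Icc, ← abs_le]
    exact_mod_cast h2
  obtain ⟨z₀, hz₀⟩ := hy 0
  obtain ⟨z₁, hz₁⟩ := hy 1
  refine ⟨(z₀, z₁), ⟨hbd 0 z₀ hz₀, hbd 1 z₁ hz₁⟩, ?_⟩
  ext i
  fin_cases i
  · simp [hz₀]
  · simp [hz₁]

/-- Two of any five lattice points agree modulo `2`, so that their midpoint is a lattice point. -/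
theorem hellyProperty_integerLattice : HellyProperty integerLattice 4 := by
  classical
  refine hellyProperty_of_exists_mem_openSegment (fun T _ => finite_inter_integerLattice
    (T.finite_toSet.isCompact_convexHull ℝ).isBounded) fun T hT hcard => ?_
  let r : Plane → ZMod 2 × ZMod 2 := fun y => (((⌊y 0⌋ : ℤ) : ZMod 2), ((⌊y 1⌋ : ℤ) : ZMod 2))
  obtain ⟨a, ha, b, hb, hab, hr⟩ := Finset.exists_ne_map_eq_of_card_lt_of_maps_to
    (s := T) (t := Finset.univ) (f := r)
    (by rw [hcard, Finset.card_univ, Fintype.card_prod, ZMod.card]; norm_num)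
    (fun _ _ => Finset.mem_coe.2 (Finset.mem_univ _))
  refine ⟨a, ha, b, hb, hab, (1 / 2 : ℝ) • a + (1 / 2 : ℝ) • b, fun i => ?_,
    ⟨1 / 2, 1 / 2, by norm_num, by norm_num, by norm_num, rfl⟩⟩
  have hi : ((⌊a i⌋ : ℤ) : ZMod 2) = ((⌊b i⌋ : ℤ) : ZMod 2) := by
    fin_cases i
    · exact congrArg Prod.fst hr
    · exact congrArg Prod.snd hr
  obtain ⟨y, hy⟩ := hT ha i
  obtain ⟨z, hz⟩ := hT hb i
  rw [hy, hz, Int.floor_intCast, Int.floor_intCast, ZMod.intCast_eq_intCast_iff_dvd_sub] at hi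
  obtain ⟨w, hw⟩ := hi
  refine ⟨y + w, ?_⟩
  have hw' : (z : ℝ) - y = 2 * w := by exact_mod_cast hw
  simp only [PiLp.add_apply, PiLp.smul_apply, smul_eq_mul, hy, hz]
  push_cast
  linarith

/-- The diagonals of the unit square do not cross in a lattice point. -/
theorem not_hellyProperty_three_of_unitSquare {S : Set Plane} (hS : S ⊆ integerLattice)
    (h00 : !₂[0, 0] ∈ S) (h10 : !₂[1, 0] ∈ S) (h01 : !₂[0, 1] ∈ S) (h11 : !₂[1, 1] ∈ S) :
    ¬ HellyProperty S 3 := by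
  intro h
  have hp := h.mem_of_crossing (p := !₂[1 / 2, 1 / 2]) h00 h11 h10 h01
    ⟨1 / 2, 1 / 2, by norm_num, by norm_num, by norm_num, by ext i; fin_cases i <;> simp⟩
    ⟨1 / 2, 1 / 2, by norm_num, by norm_num, by norm_num, by ext i; fin_cases i <;> simp⟩
    (by simp [crossMap_apply])
  obtain ⟨z, hz⟩ := hS hp 0
  have h1 : (2 * z : ℝ) = 1 := by
    rw [← hz]
    simp
  have h2 : 2 * z = 1 := by exact_mod_cast h1
  omega

theorem hellyNumber_integerLattice : hellyNumber integerLattice = (4 : ℕ) := by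
  refine hellyNumber_eq_succ hellyProperty_integerLattice
    (not_hellyProperty_three_of_unitSquare subset_rfl ?_ ?_ ?_ ?_)
  · simpa using mem_integerLattice 0 0
  · simpa using mem_integerLattice 1 0
  · simpa using mem_integerLattice 0 1
  · simpa using mem_integerLattice 1 1

end Lattice

/-! ### Sets with Helly number four -/

section Examples

/-- The vertices of the unit square. -/
def unitSquare : Set Plane := {!₂[0, 0], !₂[1, 0], !₂[0, 1], !₂[1, 1]}

theorem unitSquare_subset : ∃ F : Finset Plane, unitSquare = F ∧ F.card ≤ 4 := by
  classical
  exact ⟨{!₂[0, 0], !₂[1, 0], !₂[0, 1], !₂[1, 1]}, by simp [unitSquare], Finset.card_le_four⟩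

theorem hellyNumber_unitSquare : hellyNumber unitSquare = (4 : ℕ) := by
  refine hellyNumber_eq_succ ?_ (not_hellyProperty_three_of_unitSquare ?_ ?_ ?_ ?_ ?_)
  · refine hellyProperty_of_forall_exists_mem_convexHull_diff fun T hT hcard => ?_
    obtain ⟨F, hF, hF4⟩ := unitSquare_subset
    rw [hF] at hT
    have := Finset.card_le_card (Finset.coe_subset.1 hT)
    omega
  · rintro y (rfl | rfl | rfl | rfl)
    · simpa using mem_integerLattice 0 0
    · simpa using mem_integerLattice 1 0
    · simpa using mem_integerLattice 0 1
    · simpa using mem_integerLattice 1 1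
  all_goals simp [unitSquare]

/-- Among five points of a four-element set there is a repeated one. -/
theorem tverbergNumber_unitSquare_le : tverbergNumber unitSquare 2 ≤ (5 : ℕ) := by
  classical
  refine tverbergNumber_le (by norm_num) (by norm_num) fun x hx => ?_
  obtain ⟨F, hF, hF4⟩ := unitSquare_subset
  obtain ⟨i, -, j, -, hij, hxij⟩ := Finset.exists_ne_map_eq_of_card_lt_of_maps_to
    (s := (Finset.univ : Finset (Fin 5))) (t := F) (f := x)
    (by rw [Finset.card_fin]; omega) (fun i _ => hF ▸ hx i)
  have h := splitsAround_card (x := x) (I := {i, j}) (p := x i) (by simp [hxij])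
  rw [Finset.card_pair hij] at h
  exact ⟨x i, hx i, h.mono (Finset.subset_univ _)⟩

/-- The vertices, in cyclic order, of a convex pentagon around the origin, no diagonal of which
contains the origin. -/
noncomputable def pentagonVertex : Fin 5 → Plane :=
  ![!₂[0, 2], !₂[2, 1], !₂[1, -2], !₂[-1, -2], !₂[-2, 1]]

theorem pentagonVertex_eq : pentagonVertex 0 = !₂[0, 2] ∧ pentagonVertex 1 = !₂[2, 1] ∧
    pentagonVertex 2 = !₂[1, -2] ∧ pentagonVertex 3 = !₂[-1, -2] ∧ pentagonVertex 4 = !₂[-2, 1] :=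
  ⟨rfl, rfl, rfl, rfl, rfl⟩

theorem fin_five_cases (i : Fin 5) : i = 0 ∨ i = 1 ∨ i = 2 ∨ i = 3 ∨ i = 4 := by
  revert i
  decide

theorem exists_forall_lt_pentagonVertex (i : Fin 5) :
    ∃ f : Plane →ₗ[ℝ] ℝ, ∀ j ≠ i, f (pentagonVertex j) < f (pentagonVertex i) := by
  rcases fin_five_cases i with rfl | rfl | rfl | rfl | rfl
  · refine ⟨crossMap !₂[1, 0], fun j hj => ?_⟩
    rcases fin_five_cases j with rfl | rfl | rfl | rfl | rfl <;>
      first | exact absurd rfl hj | norm_num [crossMap_apply, pentagonVertex_eq]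
  · refine ⟨crossMap !₂[1, -2], fun j hj => ?_⟩
    rcases fin_five_cases j with rfl | rfl | rfl | rfl | rfl <;>
      first | exact absurd rfl hj | norm_num [crossMap_apply, pentagonVertex_eq]
  · refine ⟨crossMap !₂[-2, -1], fun j hj => ?_⟩
    rcases fin_five_cases j with rfl | rfl | rfl | rfl | rfl <;>
      first | exact absurd rfl hj | norm_num [crossMap_apply, pentagonVertex_eq]
  · refine ⟨crossMap !₂[-2, 1], fun j hj => ?_⟩
    rcases fin_five_cases j with rfl | rfl | rfl | rfl | rfl <;>
      first | exact absurd rfl hj | norm_num [crossMap_apply, pentagonVertex_eq]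
  · refine ⟨crossMap !₂[1, 2], fun j hj => ?_⟩
    rcases fin_five_cases j with rfl | rfl | rfl | rfl | rfl <;>
      first | exact absurd rfl hj | norm_num [crossMap_apply, pentagonVertex_eq]

theorem pentagonVertex_injective : Function.Injective pentagonVertex := by
  intro i j hij
  by_contra hne
  obtain ⟨f, hf⟩ := exists_forall_lt_pentagonVertex i
  exact (hf j (Ne.symm hne)).ne (by rw [hij])

/-- Each edge of the pentagon is separated from the other vertices by a line through the origin. -/
theorem exists_forall_neg_pentagonVertex (i : Fin 5) :
    ∃ f : Plane →ₗ[ℝ] ℝ, ∀ j, j ≠ i → j ≠ i + 1 → f (pentagonVertex j) < 0 := by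
  rcases fin_five_cases i with rfl | rfl | rfl | rfl | rfl
  · refine ⟨crossMap !₂[2, -3], fun j hj hj' => ?_⟩
    rcases fin_five_cases j with rfl | rfl | rfl | rfl | rfl <;>
      first | exact absurd rfl hj | exact absurd rfl hj' |
        norm_num [crossMap_apply, pentagonVertex_eq]
  · refine ⟨crossMap !₂[-1, -3], fun j hj hj' => ?_⟩
    rcases fin_five_cases j with rfl | rfl | rfl | rfl | rfl <;>
      first | exact absurd rfl hj | exact absurd rfl hj' |
        norm_num [crossMap_apply, pentagonVertex_eq]
  · refine ⟨crossMap !₂[-1, 0], fun j hj hj' => ?_⟩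
    rcases fin_five_cases j with rfl | rfl | rfl | rfl | rfl <;>
      first | exact absurd rfl hj | exact absurd rfl hj' |
        norm_num [crossMap_apply, pentagonVertex_eq]
  · refine ⟨crossMap !₂[-1, 3], fun j hj hj' => ?_⟩
    rcases fin_five_cases j with rfl | rfl | rfl | rfl | rfl <;>
      first | exact absurd rfl hj | exact absurd rfl hj' |
        norm_num [crossMap_apply, pentagonVertex_eq]
  · refine ⟨crossMap !₂[2, 3], fun j hj hj' => ?_⟩
    rcases fin_five_cases j with rfl | rfl | rfl | rfl | rfl <;>
      first | exact absurd rfl hj | exact absurd rfl hj' |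
        norm_num [crossMap_apply, pentagonVertex_eq]

/-- The vertices of a convex pentagon together with the origin. -/
def pointedPentagon : Set Plane := insert 0 (Set.range pentagonVertex)

theorem mem_convexHull_of_three {E : Type*} [AddCommGroup E] [Module ℝ E] {s : Set E} {u v w p : E}
    (hu : u ∈ s) (hv : v ∈ s) (hw : w ∈ s) (a b c : ℝ) (ha : 0 ≤ a) (hb : 0 ≤ b) (hc : 0 ≤ c)
    (habc : a + b + c = 1) (hp : a • u + b • v + c • w = p) : p ∈ convexHull ℝ s := by
  have := (convex_convexHull ℝ s).sum_mem (t := Finset.univ) (w := ![a, b, c]) (z := ![u, v, w])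
    (by intro i _; fin_cases i <;> simp [ha, hb, hc])
    (by simp [Fin.sum_univ_three, habc])
    (by
      intro i _
      fin_cases i
      · exact subset_convexHull ℝ _ hu
      · exact subset_convexHull ℝ _ hv
      · exact subset_convexHull ℝ _ hw)
  simpa [Fin.sum_univ_three, hp] using this

theorem zero_mem_convexHull_pentagon {s : Set Plane} (i : Fin 5)
    (hs : ∀ j ≠ i, pentagonVertex j ∈ s) : 0 ∈ convexHull ℝ s := by
  by_cases h0 : i = 0 ∨ i = 2
  · rcases h0 with rfl | rfl
    · refine mem_convexHull_of_three (hs 1 (by decide)) (hs 3 (by decide)) (hs 4 (by decide))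
        (5 / 12) (4 / 12) (3 / 12) (by norm_num) (by norm_num) (by norm_num) (by norm_num) ?_
      ext i
      fin_cases i <;> norm_num [pentagonVertex_eq]
    · refine mem_convexHull_of_three (hs 3 (by decide)) (hs 0 (by decide)) (hs 1 (by decide))
        (4 / 9) (3 / 9) (2 / 9) (by norm_num) (by norm_num) (by norm_num) (by norm_num) ?_
      ext i
      fin_cases i <;> norm_num [pentagonVertex_eq]
  by_cases h3 : i = 3
  · subst h3
    refine mem_convexHull_of_three (hs 4 (by decide)) (hs 1 (by decide)) (hs 2 (by decide))
        (5 / 12) (3 / 12) (4 / 12) (by norm_num) (by norm_num) (by norm_num) (by norm_num) ?_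
    ext i
    fin_cases i <;> norm_num [pentagonVertex_eq]
  · refine mem_convexHull_of_three (hs 0 (by tauto)) (hs 2 (by tauto)) (hs 3 (by tauto))
        (1 / 2) (1 / 4) (1 / 4) (by norm_num) (by norm_num) (by norm_num) (by norm_num) ?_
    ext i
    fin_cases i <;> norm_num [pentagonVertex_eq]

theorem hellyNumber_pointedPentagon : hellyNumber pointedPentagon = (4 : ℕ) := by
  classical
  have hv : ∀ i, pentagonVertex i ∈ pointedPentagon := fun i => Or.inr ⟨i, rfl⟩
  refine hellyNumber_eq_succ ?_ fun h => ?_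
  · refine hellyProperty_of_forall_exists_mem_convexHull_diff fun T hT hcard =>
      ⟨0, Or.inl rfl, fun t ht => ?_⟩
    rw [← Finset.coe_erase]
    by_cases h0 : (0 : Plane) ∈ T.erase t
    · exact subset_convexHull ℝ _ h0
    let V := Finset.univ.image pentagonVertex
    have hV : V.card ≤ 5 := Finset.card_image_le
    have hTV : T.erase t ⊆ V := by
      intro y hy
      rcases hT (Finset.mem_of_mem_erase hy) with rfl | ⟨i, rfl⟩
      · exact absurd hy h0
      · exact Finset.mem_image_of_mem _ (Finset.mem_univ _)
    have h1 : (V \ T.erase t).card ≤ 1 := by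
      rw [Finset.card_sdiff_of_subset hTV, Finset.card_erase_of_mem ht]
      omega
    obtain ⟨y, hy⟩ := Finset.card_le_one_iff_subset_singleton.1 h1
    have hmem : ∀ j, pentagonVertex j ≠ y →
        pentagonVertex j ∈ ((T.erase t : Finset Plane) : Set Plane) := by
      intro j hj
      by_contra hcon
      refine hj (Finset.mem_singleton.1 (hy (Finset.mem_sdiff.2 ⟨?_, hcon⟩)))
      exact Finset.mem_image_of_mem _ (Finset.mem_univ _)
    by_cases hex : ∃ i, pentagonVertex i = y
    · obtain ⟨i, rfl⟩ := hex
      exact zero_mem_convexHull_pentagon i fun j hj => hmem j (pentagonVertex_injective.ne hj)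
    · exact zero_mem_convexHull_pentagon 0 fun j _ => hmem j fun hj => hex ⟨j, hj⟩
  · have hp := h.mem_of_crossing (p := !₂[0, -1]) (hv 1) (hv 3) (hv 2) (hv 4)
      ⟨1 / 3, 2 / 3, by norm_num, by norm_num, by norm_num, by
        ext i; fin_cases i <;> norm_num [pentagonVertex_eq]⟩
      ⟨2 / 3, 1 / 3, by norm_num, by norm_num, by norm_num, by
        ext i; fin_cases i <;> norm_num [pentagonVertex_eq]⟩
      (by norm_num [crossMap_apply, pentagonVertex_eq])
    rcases hp with hp | ⟨i, hp⟩
    · simpa using congrArg (fun u : Plane => u 1) hp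
    · have := congrArg (fun u : Plane => u 1) hp
      rcases fin_five_cases i with rfl | rfl | rfl | rfl | rfl <;>
        norm_num [pentagonVertex_eq] at this

/-- The five vertices have no Tverberg partition into two parts. A common vertex would be in both
parts. If the origin were in both hulls, each part would contain an end of each edge of the
pentagon, so the parts would alternate around it, although five is odd. -/
theorem le_tverbergNumber_pointedPentagon : (6 : ℕ) ≤ tverbergNumber pointedPentagon 2 := by
  refine le_sInf ?_
  rintro _ ⟨n, -, hn, rfl⟩
  by_contra! hlt
  have hlt' : n ≤ 5 := Nat.lt_succ_iff.1 (by exact_mod_cast hlt)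
  let A : Multiset Plane := Finset.univ.val.map pentagonVertex
  have hA : A.Nodup := Finset.univ.nodup.map pentagonVertex_injective
  obtain ⟨A', hA'A, hA'n⟩ := exists_multiset_le_card_eq (A := A) (n := n) (by simpa [A] using hlt')
  have hA' : ∀ y ∈ A', ∃ i, pentagonVertex i = y := fun y hy => by
    obtain ⟨i, -, hi⟩ := Multiset.mem_map.1 (Multiset.mem_of_le hA'A hy)
    exact ⟨i, hi⟩
  obtain ⟨B, hB, p, hp, hpB⟩ := hn A' hA'n fun y hy => Or.inr (hA' y hy)
  have hdisj : ∀ y, y ∈ B 0 → y ∈ B 1 → False := by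
    have h1 := Multiset.nodup_of_le hA'A hA
    rw [← hB, Fin.sum_univ_two, Multiset.nodup_add] at h1
    exact fun y h0 h1' => Multiset.disjoint_left.1 h1.2.2 h0 h1'
  have hBA : ∀ l, ∀ y ∈ B l, ∃ i, pentagonVertex i = y := fun l y hy =>
    hA' y (hB ▸ Multiset.mem_sum.2 ⟨l, Finset.mem_univ _, hy⟩)
  rcases hp with rfl | ⟨i, rfl⟩
  · have hedge : ∀ l i, pentagonVertex i ∈ B l ∨ pentagonVertex (i + 1) ∈ B l := by
      intro l i
      obtain ⟨f, hf⟩ := exists_forall_neg_pentagonVertex i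
      obtain ⟨y, hy, hfy⟩ := exists_le_of_mem_convexHull (hpB l) f
      obtain ⟨j, rfl⟩ := hBA l y hy
      rw [map_zero] at hfy
      by_cases hj : j = i
      · exact Or.inl (hj ▸ hy)
      by_cases hj' : j = i + 1
      · exact Or.inr (hj' ▸ hy)
      · exact absurd (hf j hj hj') hfy.not_gt
    have step : ∀ i, pentagonVertex i ∈ B 0 ↔ pentagonVertex (i + 1) ∉ B 0 := by
      intro i
      have h0 := hedge 0 i
      have h1 := hedge 1 i
      have h2 := hdisj (pentagonVertex i)
      have h3 := hdisj (pentagonVertex (i + 1))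
      tauto
    have e0 : pentagonVertex 0 ∈ B 0 ↔ pentagonVertex 1 ∉ B 0 := step 0
    have e1 : pentagonVertex 1 ∈ B 0 ↔ pentagonVertex 2 ∉ B 0 := step 1
    have e2 : pentagonVertex 2 ∈ B 0 ↔ pentagonVertex 3 ∉ B 0 := step 2
    have e3 : pentagonVertex 3 ∈ B 0 ↔ pentagonVertex 4 ∉ B 0 := step 3
    have e4 : pentagonVertex 4 ∈ B 0 ↔ pentagonVertex 0 ∉ B 0 := step 4
    tauto
  · have hi : ∀ l, pentagonVertex i ∈ B l := by
      intro l
      obtain ⟨f, hf⟩ := exists_forall_lt_pentagonVertex i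
      obtain ⟨y, hy, hfy⟩ := exists_le_of_mem_convexHull (hpB l) f
      obtain ⟨j, rfl⟩ := hBA l y hy
      by_cases hj : j = i
      · exact hj ▸ hy
      · exact absurd (hf j hj) hfy.not_gt
    exact hdisj _ (hi 0) (hi 1)

end Examples

/-! ### Tverberg numbers of planar sets -/

theorem theorem1 :
    (∀ S : Set (EuclideanSpace ℝ (Fin 2)), S.Nonempty → IsDiscrete S → hellyNumber S < ⊤ →
      (∀ m : ℕ, 3 ≤ m → tverbergNumber S m = hellyNumber S * ((m - 1 : ℕ) : ℕ∞) + 1) ∧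
      (hellyNumber S ≤ 3 → tverbergNumber S 2 = hellyNumber S + 1) ∧
      (4 ≤ hellyNumber S →
        hellyNumber S + 1 ≤ tverbergNumber S 2 ∧ tverbergNumber S 2 ≤ hellyNumber S + 2)) ∧
    (∃ S : Set (EuclideanSpace ℝ (Fin 2)), S.Nonempty ∧ IsDiscrete S ∧
      hellyNumber S = 4 ∧ tverbergNumber S 2 = hellyNumber S + 1) ∧
    (∃ S : Set (EuclideanSpace ℝ (Fin 2)), S.Nonempty ∧ IsDiscrete S ∧
      hellyNumber S = 4 ∧ tverbergNumber S 2 = hellyNumber S + 2) ∧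
    (∀ m : ℕ, 3 ≤ m → tverbergNumber integerLattice m = ((4 * m - 3 : ℕ) : ℕ∞)) := by
  have hlower : ∀ {S : Set Plane} {k m : ℕ}, 0 < k → 1 ≤ m → ¬ HellyProperty S (k - 1) →
      ((k * (m - 1) + 1 : ℕ) : ℕ∞) ≤ tverbergNumber S m := by
    intro S k m hk hm h
    have := le_tverbergNumber hm h
    rwa [Nat.sub_add_cancel hk] at this
  have hfin : ∀ {S : Set Plane}, S.Finite → IsDiscrete S := fun hS => hS.isDiscrete
  have h4 : ∀ {S : Set Plane}, S.Nonempty → hellyNumber S = (4 : ℕ) →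
      HellyProperty S 4 ∧ ¬ HellyProperty S 3 := by
    intro S hne hS
    obtain ⟨k, hk, -, hk1, hk2⟩ := exists_hellyNumber_eq hne (hS ▸ ENat.natCast_lt_top 4)
    obtain rfl : k = 4 := by exact_mod_cast hk.symm.trans hS
    exact ⟨hk1, hk2⟩
  refine ⟨fun S hne _ hS => ?_, ⟨unitSquare, ?_, ?_, hellyNumber_unitSquare, ?_⟩,
    ⟨pointedPentagon, ?_, ?_, hellyNumber_pointedPentagon, ?_⟩, fun m hm => ?_⟩
  · obtain ⟨k, hk, hkpos, hk1, hk2⟩ := exists_hellyNumber_eq hne hS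
    rw [hk]
    refine ⟨fun m hm => ?_, fun hk3 => ?_, fun hk4 => ⟨?_, ?_⟩⟩
    · rw [le_antisymm (hk1.tverbergNumber_le hkpos (by omega) (Or.inr hm))
        (hlower hkpos (by omega) hk2)]
      push_cast
      rfl
    · have hk3' : k ≤ 3 := by exact_mod_cast hk3
      rw [le_antisymm (hk1.tverbergNumber_le hkpos le_rfl (Or.inl hk3'))
        (hlower hkpos (by omega) hk2)]
      simp
    · simpa using hlower (m := 2) hkpos (by omega) hk2
    · have hk4' : 4 ≤ k := by exact_mod_cast hk4
      exact_mod_cast hk1.tverbergNumber_two_le hk4'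
  · exact ⟨_, Or.inl rfl⟩
  · obtain ⟨F, hF, -⟩ := unitSquare_subset
    exact hfin (hF ▸ F.finite_toSet)
  · obtain ⟨-, h3⟩ := h4 ⟨_, Or.inl rfl⟩ hellyNumber_unitSquare
    rw [hellyNumber_unitSquare]
    exact le_antisymm tverbergNumber_unitSquare_le (hlower (k := 4) (by omega) (by omega) h3)
  · exact ⟨_, Or.inl rfl⟩
  · exact hfin ((Set.finite_range _).insert _)
  · obtain ⟨h4, -⟩ := h4 ⟨_, Or.inl rfl⟩ hellyNumber_pointedPentagon
    rw [hellyNumber_pointedPentagon]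
    exact le_antisymm (h4.tverbergNumber_two_le le_rfl) le_tverbergNumber_pointedPentagon
  · obtain ⟨h4, h3⟩ := h4 ⟨_, mem_integerLattice 0 0⟩ hellyNumber_integerLattice
    rw [le_antisymm (h4.tverbergNumber_le (by omega) (by omega) (Or.inr hm))
      (hlower (k := 4) (by omega) (by omega) h3)]
    congr 1
    omega
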